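/- Conventions. Spaces are compactly generated weak Hausdorff, and products are formed in that category. An orthogonal space is a continuous functor from the category of finite-dimensional real inner product spaces and linear isometric embeddings to spaces. Let $\boxtimes$ be the box product of orthogonal spaces: a morphism $X\boxtimes Y\to Z$ is the same as a natural family of continuous maps $X(V)\times Y(W)\to Z(V\oplus W)$. An operad $\mathcal{O}$ in $(\mathrm{Spc},\boxtimes)$ has an underlying symmetric sequence of orthogonal spaces $\mathcal{O}_n$ with $\Sigma_n$-action, $n\ge 0$. For a compact Lie group $G$, a $G$-representation means a finite-dimensional orthogonal one, and a $G$-embedding is a $G$-equivariant linear isometric embedding. For a $G$-representation $V$, the group $G\times\Sigma_n$ acts on $\mathcal{O}_n(V)$. A graph subgroup of $G\times\Sigma_n$ is a closed subgroup $\Gamma$ with $\Gamma\cap(\{e\}\times\Sigma_n)$ trivial; it is called admissible for $\mathcal{O}$ if $\mathcal{O}_n(V)^\Gamma\neq\emptyset$ for some $G$-representation $V$. The operad $\mathcal{O}$ is a global $N_\infty$-operad if for each $n\ge 0$ there is a $V$ with $\mathcal{O}_n(V)\neq\emptyset$, and for all compact Lie groups $G$, admissible graph subgroups $\Gamma\leqslant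 G\times\Sigma_n$, $G$-representations $V$, $l\ge 0$ and continuous $\alpha\colon\partial D^l\to\mathcal{O}_n(V)^\Gamma$ there are a $G$-embedding $\psi\colon V\to W$ into a $G$-representation $W$ and a continuous $\lambda\colon D^l\to\mathcal{O}_n(W)^\Gamma$ with $\lambda|_{\partial D^l}=\mathcal{O}_n(\psi)^\Gamma\circ\alpha$. A morphism of operads $f\colon\mathcal{O}\to\mathcal{P}$ is an equivalence if for all $n\ge 0$, compact Lie groups $G$, graph subgroups $\Gamma\leqslant G\times\Sigma_n$, $G$-representations $V$, $l\ge 0$ and continuous maps $\alpha\colon\partial D^l\to\mathcal{O}_n(V)^\Gamma$, $\beta\colon D^l\to\mathcal{P}_n(V)^\Gamma$ with $f_n(V)^\Gamma\circ\alpha=\beta|_{\partial D^l}$ there are a $G$-embedding $\psi\colon V\to W$ and a continuous $\lambda\colon D^l\to\mathcal{O}_n(W)^\Gamma$ such that $\lambda|_{\partial D^l}=\mathcal{O}_n(\psi)^\Gamma\circ\alpha$ and $f_n(W)^\Gamma\circ\lambda$ is homotopic to $\mathcal{P}_n(\psi)^\Gamma\circ\beta$ relative to $\partial D^l$. For a global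 $N_\infty$-operad $\mathcal{O}$ let $T_{\mathcal{O}}$ be the relation on compact Lie groups in which $K\leqslant_{T_{\mathcal{O}}}H$ if and only if $K$ is a closed subgroup of finite index $n$ of $H$ and the graph $\Gamma_{H/K}\leqslant H\times\Sigma_n$ of the homomorphism $H\to\Sigma_n$ describing the $H$-set $H/K$ (for some ordering of its elements) is admissible for $\mathcal{O}$. Proposition. Let $f\colon\mathcal{O}\to\mathcal{P}$ be a morphism of global $N_\infty$-operads. Then $f$ is an equivalence if and only if $T_{\mathcal{O}}=T_{\mathcal{P}}$. -/

import Mathlib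

open scoped Manifold ContDiff Topology
open TopologicalSpace (compactlyGenerated)

universe u

namespace GlobalOperads

noncomputable section

/-! ### Compact Lie groups -/

/-- A compact Lie group: a compact Hausdorff topological group which admits the structure of a
finite-dimensional smooth real Lie group. (Such a smooth structure is unique, and continuous
homomorphisms are automatically smooth, so it is not recorded as data.) -/
structure CompactLieGroup : Type 1 where
  carrier : Type
  [group : Group carrier]
  [topology : TopologicalSpace carrier]
  [isTopologicalGroup : IsTopologicalGroup carrier]
  [compactSpace : CompactSpace carrier]
  [t2Space : T2Space carrier]
  exists_lieGroup : ∃ (E : Type) (_ : NormedAddCommGroup E) (_ : NormedSpace ℝ E)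
    (_ : FiniteDimensional ℝ E) (_ : ChartedSpace E carrier), LieGroup 𝓘(ℝ, E) ∞ carrier

attribute [instance] CompactLieGroup.group CompactLieGroup.topology
  CompactLieGroup.isTopologicalGroup CompactLieGroup.compactSpace CompactLieGroup.t2Space

instance : CoeSort CompactLieGroup Type := ⟨CompactLieGroup.carrier⟩

/-! ### Finite-dimensional inner product spaces and linear isometric embeddings -/

/-- A finite-dimensional real inner product space: an object of the category `L`, whose morphisms
from `V` to `W` are the linear isometric embeddings `V →ₗᵢ[ℝ] W`. -/
structure IPSpace : Type 1 where
  carrier : Type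
  [normed : NormedAddCommGroup carrier]
  [inner : InnerProductSpace ℝ carrier]
  [finiteDimensional : FiniteDimensional ℝ carrier]

attribute [instance] IPSpace.normed IPSpace.inner IPSpace.finiteDimensional

instance : CoeSort IPSpace Type := ⟨IPSpace.carrier⟩

/-- The topology of the space of linear isometric embeddings, as a subspace of the normed space of
linear maps. -/
instance isometryTopology (V W : IPSpace) : TopologicalSpace (V →ₗᵢ[ℝ] W) :=
  TopologicalSpace.induced (fun ψ => ψ.toContinuousLinearMap) inferInstance

/-- The orthogonal direct sum `V₀ ⊕ V 0 ⊕ ⋯ ⊕ V (k - 1)`. -/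
def dsum (V₀ : IPSpace) {k : ℕ} (V : Fin k → IPSpace) : IPSpace where
  carrier := WithLp 2 (V₀ × PiLp 2 (fun i => (V i : Type)))

/-- The element `(v₀, v 0, …, v (k - 1))` of `V₀ ⊕ V 0 ⊕ ⋯ ⊕ V (k - 1)`. -/
def dsumMk {V₀ : IPSpace} {k : ℕ} {V : Fin k → IPSpace} (v₀ : V₀) (v : ∀ i, V i) : dsum V₀ V :=
  WithLp.toLp 2 (v₀, WithLp.toLp 2 v)

/-- The component in `V₀` of a vector. -/
def dsumHead {V₀ : IPSpace} {k : ℕ} {V : Fin k → IPSpace} (w : dsum V₀ V) : V₀ :=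
  WithLp.fst w

/-- The component in `V i` of a vector. -/
def dsumTail {V₀ : IPSpace} {k : ℕ} {V : Fin k → IPSpace} (w : dsum V₀ V) (i : Fin k) : V i :=
  (WithLp.snd w) i

theorem dsum_norm_sq {V₀ : IPSpace} {k : ℕ} {V : Fin k → IPSpace} (w : dsum V₀ V) :
    ‖w‖ ^ 2 = ‖dsumHead w‖ ^ 2 + ∑ i, ‖dsumTail w i‖ ^ 2 := by
  have h := WithLp.prod_norm_sq_eq_of_L2 (α := V₀) (β := PiLp 2 (fun i => (V i : Type))) w
  rw [PiLp.norm_sq_eq_of_L2] at h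
  exact h

theorem norm_eq_of_sq_eq {E F : Type} [NormedAddCommGroup E] [NormedAddCommGroup F] {x : E} {y : F}
    (h : ‖x‖ ^ 2 = ‖y‖ ^ 2) : ‖x‖ = ‖y‖ :=
  (sq_eq_sq₀ (norm_nonneg x) (norm_nonneg y)).1 h

/-- The direct sum `ψ₀ ⊕ ψ 0 ⊕ ⋯ ⊕ ψ (k - 1)` of linear isometric embeddings. -/
def dsumMap {V₀ W₀ : IPSpace} {k : ℕ} {V W : Fin k → IPSpace} (ψ₀ : V₀ →ₗᵢ[ℝ] W₀)
    (ψ : ∀ i, V i →ₗᵢ[ℝ] W i) : dsum V₀ V →ₗᵢ[ℝ] dsum W₀ W where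
  toFun w := dsumMk (ψ₀ (dsumHead w)) (fun i => ψ i (dsumTail w i))
  map_add' v w := by
    change dsumMk (ψ₀ (dsumHead v + dsumHead w)) (fun i => ψ i (dsumTail v i + dsumTail w i)) = _
    simp only [map_add]
    rfl
  map_smul' c w := by
    change dsumMk (ψ₀ (c • dsumHead w)) (fun i => ψ i (c • dsumTail w i)) = _
    simp only [map_smul]
    rfl
  norm_map' w := by
    apply norm_eq_of_sq_eq
    rw [dsum_norm_sq, dsum_norm_sq]
    change ‖ψ₀ (dsumHead w)‖ ^ 2 + ∑ i, ‖ψ i (dsumTail w i)‖ ^ 2 = _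
    simp only [LinearIsometry.norm_map]

/-- The inclusion `v ↦ (v, 0, …, 0)`. -/
def inclHead (V₀ : IPSpace) {k : ℕ} (V : Fin k → IPSpace) : V₀ →ₗᵢ[ℝ] dsum V₀ V where
  toFun v := dsumMk v (fun _ => 0)
  map_add' v w := by
    have h : (fun _ => 0 : ∀ i, V i) = (fun _ => 0) + (fun _ => 0) := by
      funext i
      exact (add_zero _).symm
    conv_lhs => rw [h]
    rfl
  map_smul' c v := by
    have h : (fun _ => 0 : ∀ i, V i) = c • (fun _ => 0) := by
      funext i
      exact (smul_zero c).symm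
    conv_lhs => rw [h]
    rfl
  norm_map' v := by
    apply norm_eq_of_sq_eq
    rw [dsum_norm_sq]
    change ‖v‖ ^ 2 + ∑ i, ‖(0 : V i)‖ ^ 2 = _
    simp

/-- The inclusion `v ↦ (0, v)` of `V` into `V₀ ⊕ V`. -/
def inclTail (V₀ V : IPSpace) : V →ₗᵢ[ℝ] dsum V₀ (fun _ : Fin 1 => V) where
  toFun v := dsumMk 0 (fun _ => v)
  map_add' v w := by
    have h : (0 : V₀) = 0 + 0 := (add_zero _).symm
    conv_lhs => rw [h]
    rfl
  map_smul' c v := by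
    have h : (0 : V₀) = c • 0 := (smul_zero c).symm
    conv_lhs => rw [h]
    rfl
  norm_map' v := by
    apply norm_eq_of_sq_eq
    rw [dsum_norm_sq]
    change ‖(0 : V₀)‖ ^ 2 + ∑ i : Fin 1, ‖v‖ ^ 2 = _
    simp

/-- The symmetry isomorphism permuting the last `k` summands, `(v₀, v) ↦ (v₀, v ∘ σ)`. -/
def dsumPerm (V₀ : IPSpace) {k : ℕ} (V : Fin k → IPSpace) (σ : Equiv.Perm (Fin k)) :
    dsum V₀ V →ₗᵢ[ℝ] dsum V₀ (fun i => V (σ i)) where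
  toFun w := dsumMk (dsumHead w) (fun i => dsumTail w (σ i))
  map_add' _ _ := rfl
  map_smul' _ _ := rfl
  norm_map' w := by
    apply norm_eq_of_sq_eq
    rw [dsum_norm_sq, dsum_norm_sq]
    change ‖dsumHead w‖ ^ 2 + ∑ i, ‖dsumTail w (σ i)‖ ^ 2 = _
    rw [Equiv.sum_comp σ (fun i => ‖dsumTail w i‖ ^ 2)]

/-- The associativity (and shuffle) isomorphism
`(V₀ ⊕ ⨁ᵢ V i) ⊕ ⨁ₐ W a ≅ V₀ ⊕ ⨁ᵢ (V i ⊕ ⨁ⱼ W (e (i, j)))`. -/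
def dsumAssoc (V₀ : IPSpace) {k m : ℕ} {n : Fin k → ℕ} (V : Fin k → IPSpace)
    (W : Fin m → IPSpace) (e : (Σ i, Fin (n i)) ≃ Fin m) :
    dsum (dsum V₀ V) W →ₗᵢ[ℝ] dsum V₀ (fun i => dsum (V i) (fun j => W (e ⟨i, j⟩))) where
  toFun w := dsumMk (dsumHead (dsumHead w)) (fun i => dsumMk (dsumTail (dsumHead w) i) (fun j => dsumTail w (e ⟨i, j⟩)))
  map_add' _ _ := rfl
  map_smul' _ _ := rfl
  norm_map' w := by
    apply norm_eq_of_sq_eq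
    rw [dsum_norm_sq, dsum_norm_sq w, dsum_norm_sq (dsumHead w)]
    have h : ∀ i, ‖(dsumMk (dsumTail (dsumHead w) i) (fun j => dsumTail w (e ⟨i, j⟩)) :
        dsum (V i) (fun j => W (e ⟨i, j⟩)))‖ ^ 2 =
        ‖dsumTail (dsumHead w) i‖ ^ 2 + ∑ j, ‖dsumTail w (e ⟨i, j⟩)‖ ^ 2 := fun i => dsum_norm_sq _
    change ‖dsumHead (dsumHead w)‖ ^ 2 + ∑ i, ‖(dsumMk (dsumTail (dsumHead w) i) (fun j => dsumTail w (e ⟨i, j⟩)) :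
        dsum (V i) (fun j => W (e ⟨i, j⟩)))‖ ^ 2 = _
    simp only [h]
    rw [Finset.sum_add_distrib, ← Equiv.sum_comp e (fun a => ‖dsumTail w a‖ ^ 2), Fintype.sum_sigma,
      add_assoc]

/-! ### Orthogonal spaces -/

/-- A space is weak Hausdorff if the image of every continuous map from a compact Hausdorff space
is closed. -/
def WeakHausdorff (X : Type u) [TopologicalSpace X] : Prop :=
  ∀ (S : Type u) [TopologicalSpace S] [CompactSpace S] [T2Space S] (g : S → X),
    Continuous g → IsClosed (Set.range g)

/-- An orthogonal space: a continuous functor from `L` to compactly generated weak Hausdorff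
spaces. (The spaces of linear isometric embeddings are compact Hausdorff, so the product in
`continuous_map` is already compactly generated.) -/
structure OrthSpace where
  obj : IPSpace → Type u
  [topology : ∀ V, TopologicalSpace (obj V)]
  [compactlyGenerated : ∀ V, CompactlyGeneratedSpace (obj V)]
  weakHausdorff : ∀ V, WeakHausdorff (obj V)
  map : ∀ {V W : IPSpace}, (V →ₗᵢ[ℝ] W) → obj V → obj W
  map_id : ∀ {V : IPSpace} (x : obj V), map LinearIsometry.id x = x
  map_comp : ∀ {U V W : IPSpace} (φ : V →ₗᵢ[ℝ] W) (ψ : U →ₗᵢ[ℝ] V) (x : obj U),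
    map (φ.comp ψ) x = map φ (map ψ x)
  continuous_map : ∀ V W : IPSpace,
    Continuous (fun p : (V →ₗᵢ[ℝ] W) × obj V => map p.1 p.2)

attribute [instance] OrthSpace.topology OrthSpace.compactlyGenerated

theorem OrthSpace.continuous_map_right (X : OrthSpace.{u}) {V W : IPSpace} (ψ : V →ₗᵢ[ℝ] W) :
    Continuous (X.map ψ) :=
  (X.continuous_map V W).comp (Continuous.prodMk_right ψ)

/-- An orthogonal space is non-empty if one of its values is. -/
def OrthSpace.IsNonempty (X : OrthSpace.{u}) : Prop := ∃ V, Nonempty (X.obj V)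

/-! ### Symmetric sequences of orthogonal spaces -/

/-- A symmetric sequence: orthogonal spaces `space n` for `n : ℕ`, with a left action of the
symmetric group `Σₙ` on `space n` by morphisms of orthogonal spaces. -/
structure SymmSeq where
  space : ℕ → OrthSpace.{u}
  [act : ∀ (n : ℕ) (V : IPSpace), MulAction (Equiv.Perm (Fin n)) ((space n).obj V)]
  [continuous_act : ∀ (n : ℕ) (V : IPSpace),
    ContinuousConstSMul (Equiv.Perm (Fin n)) ((space n).obj V)]
  map_smul : ∀ {n : ℕ} {V W : IPSpace} (ψ : V →ₗᵢ[ℝ] W) (σ : Equiv.Perm (Fin n))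
    (x : (space n).obj V), (space n).map ψ (σ • x) = σ • (space n).map ψ x

attribute [instance] SymmSeq.act SymmSeq.continuous_act

/-- A morphism of symmetric sequences of orthogonal spaces. -/
structure SymmSeq.Hom (M N : SymmSeq.{u}) where
  app : ∀ (n : ℕ) (V : IPSpace), (M.space n).obj V → (N.space n).obj V
  continuous_app : ∀ (n : ℕ) (V : IPSpace), Continuous (app n V)
  naturality : ∀ {n : ℕ} {V W : IPSpace} (ψ : V →ₗᵢ[ℝ] W) (x : (M.space n).obj V),
    app n W ((M.space n).map ψ x) = (N.space n).map ψ (app n V x)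
  equivariance : ∀ {n : ℕ} {V : IPSpace} (σ : Equiv.Perm (Fin n)) (x : (M.space n).obj V),
    app n V (σ • x) = σ • app n V x

/-! ### Representations and fixed points -/

/-- A (finite-dimensional, orthogonal) representation of `G`. -/
structure OrthRep (G : CompactLieGroup) where
  space : IPSpace
  ρ : G →* (space ≃ₗᵢ[ℝ] space)
  continuous_ρ : Continuous (fun p : G × space => ρ p.1 p.2)

/-- A `G`-embedding: a `G`-equivariant linear isometric embedding. -/
structure OrthRep.Emb {G : CompactLieGroup} (V W : OrthRep G) where
  toIsometry : V.space →ₗᵢ[ℝ] W.space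
  equivariance : ∀ (g : G) (v : V.space), toIsometry (V.ρ g v) = W.ρ g (toIsometry v)

/-- The graph subgroups of `G × Σₙ` (with `Σₙ` discrete): the closed subgroups which intersect
`1 × Σₙ` trivially. -/
def IsGraphSubgroup {G : CompactLieGroup} {n : ℕ} (Γ : Subgroup (G × Equiv.Perm (Fin n))) : Prop :=
  IsClosed[@instTopologicalSpaceProd G (Equiv.Perm (Fin n)) inferInstance ⊥]
    (Γ : Set (G × Equiv.Perm (Fin n))) ∧
  ∀ σ : Equiv.Perm (Fin n), ((1 : G), σ) ∈ Γ → σ = 1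

namespace SymmSeq

/-- The fixed points `Mₙ(V)^Γ`, where `(g, σ) ∈ G × Σₙ` acts on `Mₙ(V)` through the action of `g`
on `V` and functoriality, and the action of `σ` on `Mₙ`. -/
def fixedPoints (M : SymmSeq.{u}) {G : CompactLieGroup} {n : ℕ}
    (Γ : Subgroup (G × Equiv.Perm (Fin n))) (V : OrthRep G) : Set ((M.space n).obj V.space) :=
  {x | ∀ γ ∈ Γ, (M.space n).map (V.ρ γ.1).toLinearIsometry (γ.2 • x) = x}

/-- The map `Mₙ(ψ)^Γ : Mₙ(V)^Γ → Mₙ(W)^Γ` induced by a `G`-embedding `ψ : V → W`. -/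
def fixedMap (M : SymmSeq.{u}) {G : CompactLieGroup} {n : ℕ}
    (Γ : Subgroup (G × Equiv.Perm (Fin n))) {V W : OrthRep G} (ψ : V.Emb W) :
    C(M.fixedPoints Γ V, M.fixedPoints Γ W) where
  toFun x := ⟨(M.space n).map ψ.toIsometry x.1, fun γ hγ => by
    conv_rhs => rw [← x.2 γ hγ]
    rw [← M.map_smul, ← OrthSpace.map_comp, ← OrthSpace.map_comp]
    congr 1
    ext v
    exact (ψ.equivariance γ.1 v).symm⟩
  continuous_toFun :=
    (((M.space n).continuous_map_right ψ.toIsometry).comp continuous_subtype_val).subtype_mk _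

/-- The map `fₙ(V)^Γ : Mₙ(V)^Γ → Nₙ(V)^Γ` induced by a morphism `f : M → N`. -/
def Hom.fixedMap {M N : SymmSeq.{u}} (f : M.Hom N) {G : CompactLieGroup} {n : ℕ}
    (Γ : Subgroup (G × Equiv.Perm (Fin n))) (V : OrthRep G) :
    C(M.fixedPoints Γ V, N.fixedPoints Γ V) where
  toFun x := ⟨f.app n V.space x.1, fun γ hγ => by
    conv_rhs => rw [← x.2 γ hγ]
    rw [f.naturality, f.equivariance]⟩
  continuous_toFun := ((f.continuous_app n V.space).comp continuous_subtype_val).subtype_mk _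

end SymmSeq

/-- The closed unit disk `Dˡ`. -/
abbrev Disk (l : ℕ) : Type := Metric.closedBall (0 : EuclideanSpace ℝ (Fin l)) 1

/-- The boundary `∂Dˡ`, as a subset of the disk. -/
def diskBoundary (l : ℕ) : Set (Disk l) := {x | ‖x.1‖ = 1}

/-- The inclusion of `∂Dˡ` into `Dˡ`. -/
def diskIncl (l : ℕ) : C(diskBoundary l, Disk l) := ⟨Subtype.val, continuous_subtype_val⟩

namespace SymmSeq

/-- `f` is an equivalence of symmetric sequences: each `fₙ` is a `Σₙ`-global equivalence. -/
def Hom.IsEquivalence {M N : SymmSeq.{u}} (f : M.Hom N) : Prop :=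
  ∀ (n : ℕ) (G : CompactLieGroup) (Γ : Subgroup (G × Equiv.Perm (Fin n))), IsGraphSubgroup Γ →
    ∀ (V : OrthRep G) (l : ℕ) (α : C(diskBoundary l, M.fixedPoints Γ V))
      (β : C(Disk l, N.fixedPoints Γ V)), (f.fixedMap Γ V).comp α = β.comp (diskIncl l) →
      ∃ (W : OrthRep G) (ψ : V.Emb W) (lam : C(Disk l, M.fixedPoints Γ W)),
        lam.comp (diskIncl l) = (M.fixedMap Γ ψ).comp α ∧
        ((f.fixedMap Γ W).comp lam).HomotopicRel ((N.fixedMap Γ ψ).comp β) (diskBoundary l)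

/-- The set `F^M_{G,n}` of admissible graph subgroups of `G × Σₙ`. -/
def Admissible (M : SymmSeq.{u}) (G : CompactLieGroup) (n : ℕ)
    (Γ : Subgroup (G × Equiv.Perm (Fin n))) : Prop :=
  IsGraphSubgroup Γ ∧ ∃ V : OrthRep G, (M.fixedPoints Γ V).Nonempty

/-- `M` is an `N∞`-symmetric sequence. -/
def IsNInfty (M : SymmSeq.{u}) : Prop :=
  ∀ n : ℕ, (M.space n).IsNonempty ∧
    ∀ (G : CompactLieGroup) (Γ : Subgroup (G × Equiv.Perm (Fin n))), M.Admissible G n Γ →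
      ∀ (V : OrthRep G) (l : ℕ) (α : C(diskBoundary l, M.fixedPoints Γ V)),
        ∃ (W : OrthRep G) (ψ : V.Emb W) (lam : C(Disk l, M.fixedPoints Γ W)),
          lam.comp (diskIncl l) = (M.fixedMap Γ ψ).comp α

end SymmSeq

/-- The graph subgroup `{(h, φ h)}` of `H × Σₙ` of the homomorphism `φ : H → Σₙ` which describes the
`H`-set `A` after its elements have been ordered by `a`. -/
def graphOfSet {H : CompactLieGroup} {A : Type} [MulAction H A] {n : ℕ} (a : A ≃ Fin n) :
    Subgroup (H × Equiv.Perm (Fin n)) where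
  carrier := {γ | ∀ x : A, γ.2 (a x) = a (γ.1 • x)}
  mul_mem' := by
    intro γ δ hγ hδ x
    change γ.2 (δ.2 (a x)) = a ((γ.1 * δ.1) • x)
    rw [hδ, hγ, mul_smul]
  one_mem' := by
    intro x
    change a x = a ((1 : H) • x)
    rw [one_smul]
  inv_mem' := by
    intro γ hγ x
    change γ.2⁻¹ (a x) = a (γ.1⁻¹ • x)
    rw [Equiv.Perm.inv_eq_iff_eq, hγ, smul_inv_smul]

/-! ### Operads in orthogonal spaces with respect to the box product -/

/-- An operad in orthogonal spaces with respect to the box product `⊠`.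

A morphism out of `X₀ ⊠ X₁ ⊠ ⋯ ⊠ X_k` to `Z` is, by the universal property that defines the box
product, a family of continuous maps `X₀(V₀) × X₁(V₁) × ⋯ × X_k(V_k) → Z(V₀ ⊕ V₁ ⊕ ⋯ ⊕ V_k)`, natural
in all `Vᵢ` (products of spaces carry the compactly generated topology); the unit of `⊠` is the
constant one-point orthogonal space. The `m`-th term of the composition product `O ∘ O` is
`∐ₖ Oₖ ⊠_{Σₖ} ∐_{n₁ + ⋯ + nₖ = m} Σₘ ×_{Σ_{n₁} × ⋯ × Σ_{nₖ}} (O_{n₁} ⊠ ⋯ ⊠ O_{nₖ})`. The elements of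
`Σₘ` are written as bijections `e` from the ordered disjoint union of the sets `Fin (n i)` to `Fin m`;
so `comp e x y` plugs `y i` into the input `i` of `x`, and then gives the input `j` of `y i` the
name `e (i, j)`. The lexicographic `e` gives the usual composition morphisms. -/
structure Operad extends SymmSeq.{u} where
  comp : ∀ {k m : ℕ} {n : Fin k → ℕ} (_ : (Σ i, Fin (n i)) ≃ Fin m) {V₀ : IPSpace}
    {V : Fin k → IPSpace}, (space k).obj V₀ → (∀ i, (space (n i)).obj (V i)) →
    (space m).obj (dsum V₀ V)
  continuous_comp : ∀ {k m : ℕ} {n : Fin k → ℕ} (e : (Σ i, Fin (n i)) ≃ Fin m) (V₀ : IPSpace)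
    (V : Fin k → IPSpace),
    Continuous[compactlyGenerated.{u} ((space k).obj V₀ × (∀ i, (space (n i)).obj (V i))),
      (space m).topology (dsum V₀ V)] (fun p => comp e p.1 p.2)
  comp_naturality : ∀ {k m : ℕ} {n : Fin k → ℕ} (e : (Σ i, Fin (n i)) ≃ Fin m) {V₀ W₀ : IPSpace}
    {V W : Fin k → IPSpace} (ψ₀ : V₀ →ₗᵢ[ℝ] W₀) (ψ : ∀ i, V i →ₗᵢ[ℝ] W i) (x : (space k).obj V₀)
    (y : ∀ i, (space (n i)).obj (V i)),
    comp e ((space k).map ψ₀ x) (fun i => (space (n i)).map (ψ i) (y i)) =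
      (space m).map (dsumMap ψ₀ ψ) (comp e x y)
  /-- Equivariance with respect to `Σₘ`. -/
  smul_comp : ∀ {k m : ℕ} {n : Fin k → ℕ} (e : (Σ i, Fin (n i)) ≃ Fin m) {V₀ : IPSpace}
    {V : Fin k → IPSpace} (τ : Equiv.Perm (Fin m)) (x : (space k).obj V₀)
    (y : ∀ i, (space (n i)).obj (V i)),
    τ • comp e x y = comp (e.trans τ) x y
  /-- Compatibility with the actions of the groups `Σ_{n i}`. -/
  comp_smul_right : ∀ {k m : ℕ} {n : Fin k → ℕ} (e : (Σ i, Fin (n i)) ≃ Fin m) {V₀ : IPSpace}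
    {V : Fin k → IPSpace} (τ : ∀ i, Equiv.Perm (Fin (n i))) (x : (space k).obj V₀)
    (y : ∀ i, (space (n i)).obj (V i)),
    comp e x (fun i => τ i • y i) = comp ((Equiv.sigmaCongrRight τ).trans e) x y
  /-- Compatibility with the action of `Σₖ`. -/
  comp_smul_left : ∀ {k m : ℕ} {n : Fin k → ℕ} (e : (Σ i, Fin (n i)) ≃ Fin m) {V₀ : IPSpace}
    {V : Fin k → IPSpace} (σ : Equiv.Perm (Fin k)) (x : (space k).obj V₀)
    (y : ∀ i, (space (n i)).obj (V i)),
    (space m).map (dsumPerm V₀ V σ) (comp e (σ • x) y) =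
      comp ((Equiv.sigmaCongrLeft (β := fun i => Fin (n i)) σ).trans e) x (fun i => y (σ i))
  /-- The unit, a morphism from the constant one-point orthogonal space to `space 1`. -/
  one : ∀ V : IPSpace, (space 1).obj V
  map_one : ∀ {V W : IPSpace} (ψ : V →ₗᵢ[ℝ] W), (space 1).map ψ (one V) = one W
  one_comp : ∀ {n : ℕ} {V₀ V : IPSpace} (y : (space n).obj V),
    comp (n := fun _ : Fin 1 => n) (V := fun _ => V) (Equiv.uniqueSigma (fun _ : Fin 1 => Fin n))
      (one V₀) (fun _ => y) = (space n).map (inclTail V₀ V) y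
  comp_one : ∀ {k : ℕ} {V₀ : IPSpace} {V : Fin k → IPSpace} (x : (space k).obj V₀),
    comp (n := fun _ : Fin k => 1) (V := V) (Equiv.sigmaUnique (Fin k) (fun _ => Fin 1))
      x (fun i => one (V i)) = (space k).map (inclHead V₀ V) x
  /-- Associativity: the bijections `e`, `f` and `g`, `h` are the labels of the two ways to compose,
  and the hypothesis says that they give the same names to the inputs of the total composite. -/
  assoc : ∀ {k m r : ℕ} {n : Fin k → ℕ} {q : Fin m → ℕ} {s : Fin k → ℕ}
    (e : (Σ i, Fin (n i)) ≃ Fin m) (f : (Σ a, Fin (q a)) ≃ Fin r)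
    (g : ∀ i, (Σ j : Fin (n i), Fin (q (e ⟨i, j⟩))) ≃ Fin (s i)) (h : (Σ i, Fin (s i)) ≃ Fin r)
    (_ : ∀ (i : Fin k) (j : Fin (n i)) (t : Fin (q (e ⟨i, j⟩))),
      h ⟨i, g i ⟨j, t⟩⟩ = f ⟨e ⟨i, j⟩, t⟩)
    {V₀ : IPSpace} {V : Fin k → IPSpace} {W : Fin m → IPSpace}
    (x : (space k).obj V₀) (y : ∀ i, (space (n i)).obj (V i)) (z : ∀ a, (space (q a)).obj (W a)),
    (space r).map (dsumAssoc V₀ V W e) (comp f (comp e x y) z) =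
      comp h x (fun i => comp (g i) (y i) (fun j => z (e ⟨i, j⟩)))

namespace Operad

/-- A global `N∞`-operad is an operad whose underlying symmetric sequence is `N∞`. -/
def IsGlobalNInfty (O : Operad.{u}) : Prop := O.toSymmSeq.IsNInfty

/-- A morphism of operads. -/
structure Hom (O P : Operad.{u}) extends SymmSeq.Hom O.toSymmSeq P.toSymmSeq where
  app_comp : ∀ {k m : ℕ} {n : Fin k → ℕ} (e : (Σ i, Fin (n i)) ≃ Fin m) {V₀ : IPSpace}
    {V : Fin k → IPSpace} (x : (O.space k).obj V₀) (y : ∀ i, (O.space (n i)).obj (V i)),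
    app m (dsum V₀ V) (O.comp e x y) = P.comp e (app k V₀ x) (fun i => app (n i) (V i) (y i))
  app_one : ∀ V : IPSpace, app 1 V (O.one V) = P.one V

/-- A morphism of operads is an equivalence if its underlying morphism of symmetric sequences is. -/
def Hom.IsEquivalence {O P : Operad.{u}} (f : O.Hom P) : Prop := f.toHom.IsEquivalence

/-- The relation `T_O` of admissible transfers: `K ≤ H` holds in `T_O` if `K` is a closed subgroup of
finite index of the compact Lie group `H` and the `H`-set `H / K` is admissible for `O`, that is, the
graph subgroup associated to `H / K` (and to an ordering of its elements) is admissible. -/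
def transfers (O : Operad.{u}) (H : CompactLieGroup) (K : Subgroup H) : Prop :=
  IsClosed (K : Set H) ∧ K.FiniteIndex ∧
    ∃ a : (H ⧸ K) ≃ Fin K.index, O.toSymmSeq.Admissible H K.index (graphOfSet a)

end Operad

end

end GlobalOperads

/-!
An equivalence detects fixed points (lift a map from `D⁰`), so it preserves and reflects
admissibility of graph subgroups, and in particular the transfers.

For the converse, suppose first that a graph subgroup is admissible for `O` whenever it is admissible
for `P`. A lifting problem consisting of `α` on `∂Dˡ` and `β` on `Dˡ` is solved in two steps, each of
which enlarges the representation: `α` extends to some `λ` on `Dˡ` because `O` is `N∞`; then `f ∘ λ`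
and `β` agree on `∂Dˡ`, hence form a map on `∂Dˡ⁺¹`, and as `P` is `N∞` this map extends to `Dˡ⁺¹`,
which is the required homotopy (`homotopicRel_of_extension`,
`SymmSeq.Hom.isEquivalence_of_admissible`).

It remains to see that transfers determine admissibility (`Operad.admissible_of_transfers`). A graph
subgroup of `G × Σₙ` is the graph of a homomorphism `φ : H → Σₙ` for a closed subgroup `H ≤ G`, and
thus corresponds to an `H`-set with `n` elements. Operadic composition shows that an `H`-set is
admissible as soon as its orbits are (`Operad.hasFixedPoint_of_sigma`), and that the orbits of an
admissible `H`-set are admissible, by plugging in nullary operations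
(`Operad.hasFixedPoint_of_embedding`). The orbits have the form `H / K`, and so `H`-sets are governed
by the transfers.

This argument takes place in `H`, which requires two facts about compact Lie groups.

* A closed subgroup `H` of a compact Lie group `G` is a compact Lie group
  (`CompactLieGroup.exists_lieGroup_subgroup`). The group `G` has no small subgroups, because in a
  chart squaring has derivative `2` at the identity; hence neither has `H`. The Peter–Weyl theorem
  (`exists_isLeftStable_norm_sub_lt`) then provides a faithful orthogonal representation of `H`, and
  von Neumann's argument makes a compact group of matrices into a Lie group: its tangent directions
  generate one-parameter subgroups (`exp_smul_mem_range_of_tendsto`), and the exponential map gives a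
  chart at the identity (`exists_straightening`, `exists_lieGroup_of_chart`).
* Every orthogonal representation of `H` embeds into the restriction of one of `G`
  (`OrthRep.exists_embedding_restriction`). By the Peter–Weyl theorem there is a
  translation-finite function `φ` on `G` which is concentrated near the identity; averaging
  over `H` maps a finite-dimensional space of vector-valued functions on `G`, which contains all
  `φ • v`, equivariantly onto the given representation, and the adjoint of this map is made
  isometric by polar decomposition.
-/

namespace GlobalOperads

noncomputable section

/-! ### Gluing two disks along their boundary -/

section Gluing

theorem norm_sq_eq_dropLast (l : ℕ) (w : EuclideanSpace ℝ (Fin (l + 1))) :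
    ‖w‖ ^ 2 = ‖WithLp.toLp 2 fun i : Fin l => w i.castSucc‖ ^ 2 + w (Fin.last l) ^ 2 := by
  simp [EuclideanSpace.norm_sq_eq, Fin.sum_univ_castSucc]

/-- The projection `Dˡ⁺¹ → Dˡ` which forgets the last coordinate. -/
def dropLast (l : ℕ) : C(Disk (l + 1), Disk l) where
  toFun w := ⟨WithLp.toLp 2 fun i : Fin l => w.1 i.castSucc, by
    have h := norm_sq_eq_dropLast l w.1
    have hw : ‖w.1‖ ≤ 1 := mem_closedBall_zero_iff.1 w.2
    rw [mem_closedBall_zero_iff]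
    nlinarith [norm_nonneg w.1, sq_nonneg (w.1 (Fin.last l))]⟩
  continuous_toFun := by
    refine Continuous.subtype_mk ?_ _
    refine (PiLp.continuous_toLp 2 _).comp (continuous_pi fun i => ?_)
    fun_prop

theorem norm_sq_dropLast {l : ℕ} (w : Disk (l + 1)) :
    ‖w.1‖ ^ 2 = ‖(dropLast l w).1‖ ^ 2 + w.1 (Fin.last l) ^ 2 :=
  norm_sq_eq_dropLast l w.1

/-- The point of height `(1 - 2 s) √(1 - ‖z‖²)` over `z ∈ Dˡ`: as `s` runs from `0` to `1` it
moves from the upper to the lower hemisphere of `∂Dˡ⁺¹`. -/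
def verticalPath (l : ℕ) : C(unitInterval × Disk l, Disk (l + 1)) where
  toFun p := ⟨WithLp.toLp 2 (Fin.snoc (α := fun _ => ℝ) (fun i => p.2.1 i)
      ((1 - 2 * (p.1 : ℝ)) * Real.sqrt (1 - ‖p.2.1‖ ^ 2))), by
    have h := norm_sq_eq_dropLast l (WithLp.toLp 2 (Fin.snoc (α := fun _ => ℝ) (fun i => p.2.1 i)
      ((1 - 2 * (p.1 : ℝ)) * Real.sqrt (1 - ‖p.2.1‖ ^ 2))))
    have hz : ‖p.2.1‖ ≤ 1 := mem_closedBall_zero_iff.1 p.2.2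
    have hz' : 0 ≤ 1 - ‖p.2.1‖ ^ 2 := by nlinarith [norm_nonneg p.2.1]
    have hs : (1 - 2 * (p.1 : ℝ)) ^ 2 ≤ 1 := by nlinarith [p.1.2.1, p.1.2.2]
    simp only [Fin.snoc_castSucc, Fin.snoc_last, mul_pow, Real.sq_sqrt hz'] at h
    rw [mem_closedBall_zero_iff, ← sq_le_one_iff₀ (norm_nonneg _), h]
    change ‖p.2.1‖ ^ 2 + _ ≤ 1
    nlinarith⟩
  continuous_toFun := by
    refine Continuous.subtype_mk ((PiLp.continuous_toLp 2 _).comp (continuous_pi fun i => ?_)) _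
    refine Fin.lastCases ?_ (fun i => ?_) i
    · simp only [Fin.snoc_last]
      fun_prop
    · simp only [Fin.snoc_castSucc]
      fun_prop

theorem dropLast_verticalPath {l : ℕ} (p : unitInterval × Disk l) :
    dropLast l (verticalPath l p) = p.2 := by
  apply Subtype.ext
  ext i
  change Fin.snoc (α := fun _ => ℝ) (fun i => p.2.1 i) _ i.castSucc = _
  rw [Fin.snoc_castSucc]

theorem verticalPath_last {l : ℕ} (p : unitInterval × Disk l) :
    (verticalPath l p).1 (Fin.last l) = (1 - 2 * (p.1 : ℝ)) * Real.sqrt (1 - ‖p.2.1‖ ^ 2) := by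
  change Fin.snoc (α := fun _ => ℝ) (fun i => p.2.1 i) _ (Fin.last l) = _
  rw [Fin.snoc_last]

theorem verticalPath_mem_diskBoundary {l : ℕ} (p : unitInterval × Disk l)
    (h : (1 - 2 * (p.1 : ℝ)) ^ 2 = 1 ∨ ‖p.2.1‖ = 1) :
    verticalPath l p ∈ diskBoundary (l + 1) := by
  have hz : ‖p.2.1‖ ≤ 1 := mem_closedBall_zero_iff.1 p.2.2
  have hz' : 0 ≤ 1 - ‖p.2.1‖ ^ 2 := by nlinarith [norm_nonneg p.2.1]
  have h1 := norm_sq_dropLast (verticalPath l p)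
  rw [dropLast_verticalPath, verticalPath_last, mul_pow, Real.sq_sqrt hz'] at h1
  have h2 : ‖(verticalPath l p).1‖ ^ 2 = 1 := by
    rcases h with h | h
    · rw [h1, h]; ring
    · rw [h1, h]; ring
  change ‖(verticalPath l p).1‖ = 1
  exact (pow_eq_one_iff_of_nonneg (norm_nonneg _) two_ne_zero).1 h2

variable {X Y : Type*} [TopologicalSpace X] [TopologicalSpace Y]

/-- Two maps on `Dˡ` with the same boundary values give a map on `∂Dˡ⁺¹`: the first one on the
upper hemisphere, the second one on the lower hemisphere. -/
def glueHemispheres {l : ℕ} (v w : C(Disk l, X))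
    (h : ∀ z ∈ diskBoundary l, v z = w z) : C(diskBoundary (l + 1), X) where
  toFun p := if 0 ≤ p.1.1 (Fin.last l) then v (dropLast l p.1) else w (dropLast l p.1)
  continuous_toFun := by
    refine Continuous.if_le (by fun_prop) (by fun_prop) continuous_const (by fun_prop) ?_
    intro p hp
    apply h
    have h1 := norm_sq_dropLast p.1
    have h2 : ‖p.1.1‖ = 1 := p.2
    rw [← hp, h2] at h1
    change ‖(dropLast l p.1).1‖ = 1
    refine (pow_eq_one_iff_of_nonneg (norm_nonneg _) two_ne_zero).1 ?_
    linarith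

/-- If the map on `∂Dˡ⁺¹` glued from two maps on `Dˡ` extends over `Dˡ⁺¹` after applying `g`, then
the two maps become homotopic relative to the boundary after applying `g`. -/
theorem homotopicRel_of_extension {l : ℕ} (v w : C(Disk l, X))
    (h : ∀ z ∈ diskBoundary l, v z = w z) (g : C(X, Y)) (F : C(Disk (l + 1), Y))
    (hF : F.comp (diskIncl (l + 1)) = g.comp (glueHemispheres v w h)) :
    (g.comp v).HomotopicRel (g.comp w) (diskBoundary l) := by
  have key : ∀ (p : unitInterval × Disk l) (hp : verticalPath l p ∈ diskBoundary (l + 1)),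
      F (verticalPath l p) = g (if 0 ≤ (verticalPath l p).1 (Fin.last l) then v p.2 else w p.2) := by
    intro p hp
    have h1 := DFunLike.congr_fun hF ⟨verticalPath l p, hp⟩
    have h2 : glueHemispheres v w h ⟨verticalPath l p, hp⟩ =
        if 0 ≤ (verticalPath l p).1 (Fin.last l) then v (dropLast l (verticalPath l p))
        else w (dropLast l (verticalPath l p)) := rfl
    rw [dropLast_verticalPath] at h2
    rw [← h2]
    exact h1
  refine ⟨⟨⟨⟨fun p => F (verticalPath l p), by fun_prop⟩, ?_, ?_⟩, ?_⟩⟩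
  · intro z
    have h1 := verticalPath_last ((0 : unitInterval), z)
    refine (key (0, z) (verticalPath_mem_diskBoundary _ (Or.inl (by simp)))).trans ?_
    rw [if_pos]
    · rfl
    · rw [h1]
      simp [Real.sqrt_nonneg]
  · intro z
    have h1 := verticalPath_last ((1 : unitInterval), z)
    have hm := verticalPath_mem_diskBoundary ((1 : unitInterval), z) (Or.inl (by norm_num))
    refine (key (1, z) hm).trans ?_
    split_ifs with hpos
    · -- the point then lies on the equator, where the two maps agree
      rw [h1] at hpos
      have h3 : Real.sqrt (1 - ‖z.1‖ ^ 2) = 0 := by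
        have := Real.sqrt_nonneg (1 - ‖z.1‖ ^ 2)
        norm_num at hpos
        linarith
      have hz : ‖z.1‖ ≤ 1 := mem_closedBall_zero_iff.1 z.2
      rw [Real.sqrt_eq_zero (by nlinarith [norm_nonneg z.1])] at h3
      change g (v z) = g (w z)
      rw [h z]
      exact (pow_eq_one_iff_of_nonneg (norm_nonneg _) two_ne_zero).1 (by linarith)
    · rfl
  · intro s z hz
    refine (key (s, z) (verticalPath_mem_diskBoundary _ (Or.inr hz))).trans ?_
    change _ = g (v z)
    congr 1
    split_ifs
    · rfl
    · exact (h z hz).symm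

end Gluing

/-! ### Composition with fixed points -/

section Admissible

/-- `x ∈ Mₙ(V)` is fixed by the graph of the homomorphism `φ : G → Σₙ`. -/
def SymmSeq.IsFixedBy (M : SymmSeq.{u}) {G : CompactLieGroup} {n : ℕ}
    (φ : G →* Equiv.Perm (Fin n)) (V : OrthRep G) (x : (M.space n).obj V.space) : Prop :=
  ∀ g, (M.space n).map (V.ρ g).toLinearIsometry (φ g • x) = x

/-- The graph of `φ : G → Σₙ` has a fixed point in some value `Mₙ(V)`. -/
def SymmSeq.HasFixedPoint (M : SymmSeq.{u}) {G : CompactLieGroup} {n : ℕ}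
    (φ : G →* Equiv.Perm (Fin n)) : Prop :=
  ∃ (V : OrthRep G) (x : (M.space n).obj V.space), M.IsFixedBy φ V x

/-- A homomorphism from a group to the monoid of isometric endomorphisms takes values in the
isometric automorphisms. -/
def isometryHom {G V : Type*} [Group G] [NormedAddCommGroup V] [NormedSpace ℝ V]
    (r : G → V →ₗᵢ[ℝ] V) (h_one : r 1 = LinearIsometry.id)
    (h_mul : ∀ g h, r (g * h) = (r g).comp (r h)) : G →* (V ≃ₗᵢ[ℝ] V) where
  toFun g :=
    { toLinearEquiv := LinearEquiv.ofLinearMap (r g).toLinearMap (r g⁻¹).toLinearMap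
        (by ext v; simpa [h_one] using (DFunLike.congr_fun (h_mul g g⁻¹) v).symm)
        (by ext v; simpa [h_one] using (DFunLike.congr_fun (h_mul g⁻¹ g) v).symm)
      norm_map' := (r g).norm_map }
  map_one' := by ext v; exact DFunLike.congr_fun h_one v
  map_mul' g h := by ext v; exact DFunLike.congr_fun (h_mul g h) v

/-- A representation from a homomorphism to the monoid of isometric endomorphisms. -/
def OrthRep.ofIsometry {G : CompactLieGroup} (V : IPSpace) (r : G → V →ₗᵢ[ℝ] V)
    (h_one : r 1 = LinearIsometry.id) (h_mul : ∀ g h, r (g * h) = (r g).comp (r h))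
    (hr : Continuous fun p : G × V => r p.1 p.2) : OrthRep G where
  space := V
  ρ := isometryHom r h_one h_mul
  continuous_ρ := hr

theorem continuous_dsumMk {V₀ : IPSpace} {k : ℕ} {V : Fin k → IPSpace} {X : Type*}
    [TopologicalSpace X] {f : X → V₀} {g : ∀ i, X → V i} (hf : Continuous f)
    (hg : ∀ i, Continuous (g i)) :
    Continuous fun x => (dsumMk (f x) fun i => g i x : dsum V₀ V) := by
  unfold dsumMk
  exact (WithLp.prod_continuous_toLp 2 _ _).comp
    (hf.prodMk ((PiLp.continuous_toLp 2 _).comp (continuous_pi hg)))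

theorem continuous_dsumHead {V₀ : IPSpace} {k : ℕ} {V : Fin k → IPSpace} :
    Continuous (dsumHead : dsum V₀ V → V₀) :=
  continuous_fst.comp (WithLp.prod_continuous_ofLp 2 _ _)

theorem continuous_dsumTail {V₀ : IPSpace} {k : ℕ} {V : Fin k → IPSpace} (i : Fin k) :
    Continuous (fun w : dsum V₀ V => dsumTail w i) :=
  (continuous_apply i).comp ((PiLp.continuous_ofLp 2 _).comp
    (continuous_snd.comp (WithLp.prod_continuous_ofLp 2 _ _)))

variable (O : Operad.{u}) {G : CompactLieGroup}

/-- A family of continuous maps which depends on a parameter in a locally constant way is jointly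
continuous. -/
theorem _root_.IsLocallyConstant.continuous_uncurry {X Y Z I : Type*} [TopologicalSpace X]
    [TopologicalSpace Y] [TopologicalSpace Z] {a : X → I} (ha : IsLocallyConstant a)
    {F : I → Y → Z} (hF : ∀ i, Continuous (F i)) : Continuous fun p : X × Y => F (a p.1) p.2 := by
  rw [continuous_iff_continuousAt]
  intro p
  refine ((hF (a p.1)).comp continuous_snd).continuousAt.congr ?_
  filter_upwards [continuous_fst.continuousAt.eventually (ha.eventually_eq p.1)] with q hq
  rw [hq]
  rfl

/-- If `φ` is a disjoint union of actions which all have a fixed point, then composing an arbitrary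
`k`-ary operation with these fixed points gives a fixed point of `φ`. -/
theorem Operad.hasFixedPoint_of_sigma {k m : ℕ} {n : Fin k → ℕ} (φ : G →* Equiv.Perm (Fin m))
    (e : (Σ i, Fin (n i)) ≃ Fin m) (χ : ∀ i, G →* Equiv.Perm (Fin (n i)))
    (he : ∀ g i j, φ g (e ⟨i, j⟩) = e ⟨i, χ i g j⟩) (hk : (O.space k).IsNonempty)
    (h : ∀ i, O.HasFixedPoint (χ i)) : O.HasFixedPoint φ := by
  obtain ⟨V₀, ⟨x⟩⟩ := hk
  choose V y hy using h
  let r : G → dsum V₀ (fun i => (V i).space) →ₗᵢ[ℝ] dsum V₀ (fun i => (V i).space) := fun g =>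
    dsumMap LinearIsometry.id (fun i => ((V i).ρ g).toLinearIsometry)
  refine ⟨OrthRep.ofIsometry (dsum V₀ fun i => (V i).space) r ?_ ?_ ?_, O.comp e x y, ?_⟩
  · ext w
    change dsumMk (dsumHead w) (fun i => (V i).ρ 1 (dsumTail w i)) = w
    simp only [_root_.map_one]
    rfl
  · intro g h
    ext w
    change dsumMk (dsumHead w) (fun i => (V i).ρ (g * h) (dsumTail w i)) = _
    simp only [_root_.map_mul]
    rfl
  · exact continuous_dsumMk (continuous_dsumHead.comp continuous_snd) fun i =>
      (V i).continuous_ρ.comp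
        (continuous_fst.prodMk ((continuous_dsumTail i).comp continuous_snd))
  · intro g
    change (O.space m).map (r g) (φ g • O.comp e x y) = _
    have h1 : e.trans (φ g) = (Equiv.sigmaCongrRight fun i => χ i g).trans e := by
      ext ⟨i, j⟩
      exact congrArg Fin.val (he g i j)
    rw [O.smul_comp, h1, ← O.comp_smul_right, ← O.comp_naturality, OrthSpace.map_id]
    congr 1
    funext i
    exact hy i g

/-- The composite does not change if the operations plugged in, which all depend only on a
colouring of the inputs, are described by a propositionally equal colouring. -/
theorem Operad.comp_congr_colouring {k m : ℕ} {C : Type*} (N : C → ℕ) {V₀ V : IPSpace}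
    (x : (O.space k).obj V₀) (y : ∀ b, (O.space (N b)).obj V) {c c' : Fin k → C} (hc : c' = c)
    (e' : (Σ i, Fin (N (c' i))) ≃ Fin m) (e : (Σ i, Fin (N (c i))) ≃ Fin m)
    (he : ∀ i j (h' : j < N (c' i)) (h : j < N (c i)), e' ⟨i, j, h'⟩ = e ⟨i, j, h⟩) :
    O.comp (V := fun _ => V) e' x (fun i => y (c' i)) =
      O.comp (V := fun _ => V) e x (fun i => y (c i)) := by
  subst hc
  congr 1
  ext ⟨i, j⟩
  rw [he i j.1 j.2 j.2]

/-- If an action on `Fin n` has a fixed point, so does every invariant subset: plug the unit into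
the inputs in the subset, and a nullary operation into the other ones. -/
theorem Operad.hasFixedPoint_of_embedding {m n : ℕ} (φ : G →* Equiv.Perm (Fin n))
    (χ : G →* Equiv.Perm (Fin m)) (ι : Fin m ↪ Fin n) (hι : ∀ g j, φ g (ι j) = ι (χ g j))
    (hφ : IsLocallyConstant φ)
    (h₀ : (O.space 0).IsNonempty) (h : O.HasFixedPoint φ) : O.HasFixedPoint χ := by
  classical
  obtain ⟨V', ⟨z⟩⟩ := h₀
  obtain ⟨V, x, hx⟩ := h
  let c : Fin n → Bool := fun i => decide (i ∈ Set.range ι)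
  have hc_mem : ∀ i, c i = true ↔ i ∈ Set.range ι := fun i => by simp [c]
  have hc : ∀ g i, c (φ g i) = c i := by
    intro g i
    rw [Bool.eq_iff_iff, hc_mem, hc_mem]
    constructor
    · rintro ⟨j, hj⟩
      refine ⟨χ g⁻¹ j, ?_⟩
      rw [← hι, hj, ← Equiv.Perm.mul_apply, ← _root_.map_mul, inv_mul_cancel, _root_.map_one]
      rfl
    · rintro ⟨j, rfl⟩
      exact ⟨χ g j, (hι g j).symm⟩
  have hcι : ∀ j, c (ι j) = true := fun j => (hc_mem _).2 ⟨j, rfl⟩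
  let y : ∀ b : Bool, (O.space b.toNat).obj V' := fun b => match b with
    | true => O.one V'
    | false => z
  let s : Fin m → Σ i, Fin (c i).toNat := fun j => ⟨ι j, ⟨0, by rw [hcι]; exact one_pos⟩⟩
  have hs : Function.Bijective s := by
    constructor
    · intro i j hij
      exact ι.injective (congrArg Sigma.fst hij)
    · rintro ⟨i, j, hj⟩
      have hi : c i = true := by
        by_contra hi
        rw [Bool.not_eq_true] at hi
        rw [hi] at hj
        exact Nat.not_lt_zero _ hj
      obtain ⟨a, rfl⟩ := (hc_mem i).1 hi
      rw [hcι] at hj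
      obtain rfl : j = 0 := Nat.lt_one_iff.1 hj
      exact ⟨a, rfl⟩
  let e : (Σ i, Fin (c i).toNat) ≃ Fin m := (Equiv.ofBijective s hs).symm
  have he : ∀ j, e (s j) = j := (Equiv.ofBijective s hs).symm_apply_apply
  let W : Fin n → IPSpace := fun _ => V'
  let r : G → dsum V.space W →ₗᵢ[ℝ] dsum V.space W := fun g =>
    (dsumPerm V.space W (φ g⁻¹)).comp
      (dsumMap (V.ρ g).toLinearIsometry fun _ => LinearIsometry.id)
  refine ⟨OrthRep.ofIsometry (dsum V.space W) r ?_ ?_ ?_,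
    O.comp (V := W) e x (fun i => y (c i)), ?_⟩
  · ext w
    let t : Equiv.Perm (Fin n) → ∀ i, W i := fun σ i => dsumTail w (σ i)
    have h1 : φ 1⁻¹ = 1 := by rw [inv_one, _root_.map_one]
    change (dsumMk (V.ρ 1 (dsumHead w)) (t (φ 1⁻¹)) : dsum V.space W) = w
    rw [h1, _root_.map_one]
    rfl
  · intro g h
    ext w
    let t : Equiv.Perm (Fin n) → ∀ i, W i := fun σ i => dsumTail w (σ i)
    have h1 : φ (g * h)⁻¹ = φ h⁻¹ * φ g⁻¹ := by rw [mul_inv_rev, _root_.map_mul]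
    change (dsumMk (V.ρ (g * h) (dsumHead w)) (t (φ (g * h)⁻¹)) : dsum V.space W) = _
    rw [h1, _root_.map_mul]
    rfl
  · refine continuous_dsumMk (V.continuous_ρ.comp
      (continuous_fst.prodMk (continuous_dsumHead.comp continuous_snd))) fun i => ?_
    have h1 : IsLocallyConstant fun g => φ g⁻¹ := hφ.comp_continuous continuous_inv
    have h2 : ∀ σ : Equiv.Perm (Fin n), Continuous fun w : dsum V.space W => dsumTail w (σ i) :=
      fun σ => continuous_dsumTail (σ i)
    exact h1.continuous_uncurry (Z := V') h2
  · intro g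
    change (O.space m).map (r g) (χ g • O.comp (V := W) e x (fun i => y (c i))) = _
    have h1 : φ g⁻¹ • x = (O.space n).map (V.ρ g).toLinearIsometry x := by
      conv_lhs => rw [← hx g]
      rw [← O.map_smul, smul_smul, ← _root_.map_mul, inv_mul_cancel, _root_.map_one, one_smul]
    have h2 := O.comp_naturality (e.trans (χ g)) (V.ρ g).toLinearIsometry
      (V := W) (W := W) (fun _ => LinearIsometry.id) x (fun i => y (c i))
    simp only [OrthSpace.map_id] at h2
    have h3 := O.comp_smul_left (V := W) (e.trans (χ g)) (φ g⁻¹) x (fun i => y (c i))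
    rw [O.smul_comp, OrthSpace.map_comp, ← h2, ← h1]
    refine h3.trans ?_
    refine O.comp_congr_colouring Bool.toNat x y (c' := fun i => c (φ g⁻¹ i))
      (funext fun i => hc g⁻¹ i) _ _ ?_
    intro i j hj' hj
    have hi : c i = true := by
      by_contra hi
      rw [Bool.not_eq_true] at hi
      rw [hi] at hj
      exact Nat.not_lt_zero _ hj
    obtain ⟨a, rfl⟩ := (hc_mem i).1 hi
    have hj0 : j = 0 := by
      rw [hcι] at hj
      exact Nat.lt_one_iff.1 hj
    subst hj0
    have h4 : (⟨φ g⁻¹ (ι a), ⟨0, hj'⟩⟩ : Σ i, Fin (c i).toNat) = s (χ g⁻¹ a) := by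
      have : ∀ (i i' : Fin n) (hi : 0 < (c i).toNat) (hi' : 0 < (c i').toNat), i = i' →
          (⟨i, ⟨0, hi⟩⟩ : Σ i, Fin (c i).toNat) = ⟨i', ⟨0, hi'⟩⟩ := by
        rintro i _ _ _ rfl
        rfl
      exact this _ _ _ _ (hι _ _)
    change χ g (e ⟨φ g⁻¹ (ι a), ⟨0, hj'⟩⟩) = e (s a)
    rw [h4, he, he, ← Equiv.Perm.mul_apply, ← _root_.map_mul, mul_inv_cancel, _root_.map_one]
    rfl

end Admissible

/-! ### Translation-finite functions on a compact group -/

section PeterWeyl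

open MeasureTheory Module.End
open scoped InnerProductSpace

variable {G : Type*} [Group G] [TopologicalSpace G] [IsTopologicalGroup G]

/-- Left translation of functions on a group, `(g φ)(x) = φ (g⁻¹ x)`. -/
def leftTranslate {E : Type*} [NormedAddCommGroup E] [NormedSpace ℝ E] (g : G) :
    C(G, E) →ₗ[ℝ] C(G, E) where
  toFun φ := φ.comp ⟨fun x => g⁻¹ * x, by fun_prop⟩
  map_add' _ _ := rfl
  map_smul' _ _ := rfl

@[simp]
theorem leftTranslate_apply {E : Type*} [NormedAddCommGroup E] [NormedSpace ℝ E] (g : G)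
    (φ : C(G, E)) (x : G) : leftTranslate g φ x = φ (g⁻¹ * x) := rfl

/-- A space of functions on a group which is invariant under left translation. -/
def IsLeftStable {E : Type*} [NormedAddCommGroup E] [NormedSpace ℝ E]
    (W : Submodule ℝ C(G, E)) : Prop :=
  ∀ g, ∀ φ ∈ W, leftTranslate g φ ∈ W

theorem IsLeftStable.sup {E : Type*} [NormedAddCommGroup E] [NormedSpace ℝ E]
    {W W' : Submodule ℝ C(G, E)} (h : IsLeftStable W) (h' : IsLeftStable W') :
    IsLeftStable (W ⊔ W') := by
  intro g φ hφ
  obtain ⟨a, ha, b, hb, rfl⟩ := Submodule.mem_sup.1 hφ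
  rw [map_add]
  exact Submodule.add_mem_sup (h g a ha) (h' g b hb)

variable [CompactSpace G] [MeasurableSpace G] [BorelSpace G]
  (μ : Measure G) [μ.IsHaarMeasure]

/-- The class in `L²` of a continuous function. -/
local notation "toL2" => ContinuousMap.toLp (E := ℝ) (α := G) 2 μ ℝ

/-- The function `x ↦ k (x⁻¹ ·)` with values in `L²`. -/
def convKernel (k : C(G, ℝ)) : C(G, Lp ℝ 2 μ) where
  toFun x := toL2 (leftTranslate x k)
  continuous_toFun := by
    refine (toL2).continuous.comp ?_
    exact (ContinuousMap.curry ⟨fun p : G × G => k (p.1⁻¹ * p.2), by fun_prop⟩).continuous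

/-- The convolution operator `f ↦ (x ↦ ∫ k (x⁻¹ y) f(y) dy)` from `L²` to continuous functions. -/
def convOperator (k : C(G, ℝ)) : Lp ℝ 2 μ →L[ℝ] C(G, ℝ) :=
  LinearMap.mkContinuous
    { toFun := fun f => ⟨fun x => ⟪convKernel μ k x, f⟫_ℝ, by fun_prop⟩
      map_add' := fun f g => by ext x; simp [inner_add_right]
      map_smul' := fun c f => by ext x; simp [inner_smul_right] }
    ‖convKernel μ k‖ fun f => by
      rw [ContinuousMap.norm_le _ (by positivity)]
      intro x
      refine (norm_inner_le_norm (𝕜 := ℝ) (convKernel μ k x) f).trans ?_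
      gcongr
      exact (convKernel μ k).norm_coe_le_norm x

theorem convOperator_apply (k : C(G, ℝ)) (f : Lp ℝ 2 μ) (x : G) :
    convOperator μ k f x = ⟪convKernel μ k x, f⟫_ℝ := rfl

theorem convOperator_toLp (k φ : C(G, ℝ)) (x : G) :
    convOperator μ k (toL2 φ) x = ∫ y, k (x⁻¹ * y) * φ y ∂μ := by
  rw [convOperator_apply]
  change ⟪toL2 (leftTranslate x k), toL2 φ⟫_ℝ = _
  rw [ContinuousMap.inner_toLp]
  simp [mul_comm]

theorem convOperator_toLp_leftTranslate (k φ : C(G, ℝ)) (g : G) :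
    convOperator μ k (toL2 (leftTranslate g φ)) =
      leftTranslate g (convOperator μ k (toL2 φ)) := by
  ext x
  rw [leftTranslate_apply, convOperator_toLp, convOperator_toLp,
    ← integral_mul_left_eq_self _ g]
  simp [mul_assoc]

/-- By the Arzelà–Ascoli theorem the convolution operator is compact. -/
theorem isCompactOperator_convOperator (k : C(G, ℝ)) :
    IsCompactOperator ((toL2).comp (convOperator μ k)) := by
  let B : Lp ℝ 2 μ →L[ℝ] BoundedContinuousFunction G ℝ :=
    (ContinuousMap.linearIsometryBoundedOfCompact G ℝ ℝ).toLinearIsometry.toContinuousLinearMap.comp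
      (convOperator μ k)
  have hB : IsCompactOperator B := by
    refine (isCompactOperator_iff_isCompact_closure_image_closedBall (B : Lp ℝ 2 μ →ₗ[ℝ] BoundedContinuousFunction G ℝ)
      one_pos).2 ?_
    refine BoundedContinuousFunction.arzela_ascoli (Metric.closedBall (0 : ℝ) ‖convKernel μ k‖)
      (isCompact_closedBall _ _) _ ?_ ?_
    · rintro _ x ⟨f, hf, rfl⟩
      rw [mem_closedBall_zero_iff] at hf ⊢
      calc ‖⟪convKernel μ k x, f⟫_ℝ‖ ≤ ‖convKernel μ k x‖ * ‖f‖ := norm_inner_le_norm _ _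
        _ ≤ ‖convKernel μ k‖ * 1 := by
          gcongr
          exact (convKernel μ k).norm_coe_le_norm x
        _ = _ := mul_one _
    · intro x
      rw [Metric.equicontinuousAt_iff_right]
      intro ε hε
      filter_upwards [(convKernel μ k).continuous.continuousAt (Metric.ball_mem_nhds _ hε)]
        with y hy
      rintro ⟨_, f, hf, rfl⟩
      rw [mem_closedBall_zero_iff] at hf
      rw [Set.mem_preimage, mem_ball_iff_norm'] at hy
      change dist ⟪convKernel μ k x, f⟫_ℝ ⟪convKernel μ k y, f⟫_ℝ < ε
      rw [dist_eq_norm, ← inner_sub_left]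
      calc _ ≤ ‖convKernel μ k x - convKernel μ k y‖ * ‖f‖ := norm_inner_le_norm _ _
        _ ≤ ‖convKernel μ k x - convKernel μ k y‖ * 1 := by gcongr
        _ < ε := by rwa [mul_one]
  exact hB.clm_comp (BoundedContinuousFunction.toLp 2 μ ℝ)

theorem isSymmetric_convOperator [μ.WeaklyRegular] (k : C(G, ℝ)) (hk : ∀ t, k t⁻¹ = k t) :
    ((toL2).comp (convOperator μ k)).IsSymmetric := by
  have hd : DenseRange (toL2) := ContinuousMap.toLp_denseRange ℝ μ ℝ (by simp)
  intro f g
  refine hd.induction_on₂ (p := fun f g => ⟪((toL2).comp (convOperator μ k)) f, g⟫_ℝ =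
    ⟪f, ((toL2).comp (convOperator μ k)) g⟫_ℝ) ?_ ?_ f g
  · exact isClosed_eq (by fun_prop) (by fun_prop)
  · intro φ χ
    simp only [ContinuousLinearMap.comp_apply]
    rw [ContinuousMap.inner_toLp, ContinuousMap.inner_toLp]
    simp only [convOperator_toLp, conj_trivial, ← integral_const_mul, ← integral_mul_const]
    rw [integral_integral_swap_of_hasCompactSupport]
    · refine integral_congr_ae (.of_forall fun x => integral_congr_ae (.of_forall fun y => ?_))
      simp only
      rw [← hk (x⁻¹ * y), mul_inv_rev, inv_inv]
      ring
    · fun_prop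
    · exact HasCompactSupport.of_compactSpace _

/-- Convolution maps every sum of eigenvectors to a translation-finite function. -/
theorem exists_isLeftStable_convOperator (k : C(G, ℝ))
    {f : Lp ℝ 2 μ} (hf : f ∈ ⨆ ν, eigenspace (((toL2).comp (convOperator μ k) :
      Lp ℝ 2 μ →L[ℝ] Lp ℝ 2 μ) : Module.End ℝ (Lp ℝ 2 μ)) ν) :
    ∃ W : Submodule ℝ C(G, ℝ), FiniteDimensional ℝ W ∧ IsLeftStable W ∧ convOperator μ k f ∈ W := by
  induction hf using Submodule.iSup_induction' with
  | mem ν f hf =>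
    rw [mem_eigenspace_iff] at hf
    change toL2 (convOperator μ k f) = ν • f at hf
    by_cases hν : ν = 0
    · refine ⟨⊥, inferInstance, fun g φ hφ => ?_, ?_⟩
      · rw [Submodule.mem_bot] at hφ ⊢
        rw [hφ, map_zero]
      · rw [Submodule.mem_bot]
        refine ContinuousMap.toLp_injective (p := 2) (𝕜 := ℝ) μ ?_
        rw [hf, hν, zero_smul, map_zero]
    · have := ContinuousLinearMap.finite_dimensional_eigenspace
        (isCompactOperator_convOperator μ k) ν hν
      refine ⟨(eigenspace (((toL2).comp (convOperator μ k) : Lp ℝ 2 μ →L[ℝ] Lp ℝ 2 μ) :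
        Module.End ℝ (Lp ℝ 2 μ)) ν).map (convOperator μ k : Lp ℝ 2 μ →ₗ[ℝ] C(G, ℝ)),
        inferInstance, ?_, f, mem_eigenspace_iff.2 hf, rfl⟩
      rintro g _ ⟨f', hf', rfl⟩
      change f' ∈ eigenspace _ _ at hf'
      rw [mem_eigenspace_iff] at hf'
      change toL2 (convOperator μ k f') = ν • f' at hf'
      have h1 : convOperator μ k (ν⁻¹ • toL2 (leftTranslate g (convOperator μ k f'))) =
          leftTranslate g (convOperator μ k f') := by
        rw [map_smul, convOperator_toLp_leftTranslate, hf', map_smul, map_smul, smul_smul,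
          inv_mul_cancel₀ hν, one_smul]
      refine ⟨ν⁻¹ • toL2 (leftTranslate g (convOperator μ k f')), ?_, h1⟩
      refine mem_eigenspace_iff.2 ?_
      change toL2 (convOperator μ k _) = _
      rw [h1, smul_smul, mul_inv_cancel₀ hν, one_smul]
  | zero =>
    refine ⟨⊥, inferInstance, fun g φ hφ => ?_, by simp⟩
    rw [Submodule.mem_bot] at hφ ⊢
    rw [hφ, map_zero]
  | add f g _ _ hf hg =>
    obtain ⟨W, h1, h2, h3⟩ := hf
    obtain ⟨W', h1', h2', h3'⟩ := hg
    exact ⟨W ⊔ W', inferInstance, h2.sup h2', by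
      rw [map_add]; exact Submodule.add_mem_sup h3 h3'⟩

variable [T2Space G]

/-- There are symmetric kernels which concentrate near the identity. -/
theorem exists_symmetric_kernel (V : Set G) (hV : V ∈ 𝓝 1) :
    ∃ k : C(G, ℝ), (∀ t, 0 ≤ k t) ∧ (∀ t, k t⁻¹ = k t) ∧ (∀ t ∉ V, k t = 0) ∧
      ∫ t, k t ∂μ = 1 := by
  obtain ⟨f, hf0, hf1, hf⟩ := exists_continuous_zero_one_of_isClosed
    (isOpen_interior (s := V)).isClosed_compl (isClosed_singleton (x := (1 : G)))
    (by rw [Set.disjoint_singleton_right, Set.notMem_compl_iff]; exact mem_interior_iff_mem_nhds.2 hV)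
  let k₀ : C(G, ℝ) := ⟨fun t => f t * f t⁻¹, by fun_prop⟩
  have hk₀ : ∀ t, 0 ≤ k₀ t := fun t => mul_nonneg (hf t).1 (hf t⁻¹).1
  have hpos : 0 < ∫ t, k₀ t ∂μ := by
    refine k₀.continuous.integral_pos_of_hasCompactSupport_nonneg_nonzero
      (HasCompactSupport.of_compactSpace _) hk₀ (x := 1) ?_
    change f 1 * f 1⁻¹ ≠ 0
    rw [inv_one, hf1 rfl]
    simp
  refine ⟨(∫ t, k₀ t ∂μ)⁻¹ • k₀, fun t => ?_, fun t => ?_, fun t ht => ?_, ?_⟩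
  · exact mul_nonneg (inv_nonneg.2 hpos.le) (hk₀ t)
  · change _ * (f t⁻¹ * f t⁻¹⁻¹) = _ * (f t * f t⁻¹)
    rw [inv_inv, mul_comm (f t)]
  · change _ * (f t * f t⁻¹) = 0
    rw [hf0 (fun h => ht (interior_subset h))]
    simp
  · change ∫ t, _ * k₀ t ∂μ = 1
    rw [integral_const_mul, inv_mul_cancel₀ hpos.ne']

/-- The Peter–Weyl theorem, in the form that translation-finite functions are uniformly dense. -/
theorem exists_isLeftStable_norm_sub_lt [μ.WeaklyRegular] (F : C(G, ℝ)) {ε : ℝ} (hε : 0 < ε) :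
    ∃ W : Submodule ℝ C(G, ℝ), FiniteDimensional ℝ W ∧ IsLeftStable W ∧
      ∃ φ ∈ W, ‖φ - F‖ < ε := by
  have hV : {t : G | ∀ x, |F (x * t) - F x| ≤ ε / 2} ∈ 𝓝 (1 : G) := by
    let c : C(G, C(G, ℝ)) := ContinuousMap.curry ⟨fun p : G × G => F (p.2 * p.1), by fun_prop⟩
    have h1 : c 1 = F := by ext x; simp [c]
    filter_upwards [c.continuous.continuousAt (Metric.closedBall_mem_nhds (c 1) (half_pos hε))]
      with t ht x
    rw [Set.mem_preimage, mem_closedBall_iff_norm, h1] at ht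
    exact ((c t - F).norm_coe_le_norm x).trans ht
  obtain ⟨k, hk0, hksymm, hkV, hk1⟩ := exists_symmetric_kernel μ _ hV
  have hs := isSymmetric_convOperator μ k hksymm
  have happrox : ∀ x, |convOperator μ k (toL2 F) x - F x| ≤ ε / 2 := by
    intro x
    have hint : ∀ φ : C(G, ℝ), Integrable φ μ := fun φ =>
      φ.continuous.integrable_of_hasCompactSupport (HasCompactSupport.of_compactSpace _)
    have h1 : convOperator μ k (toL2 F) x - F x = ∫ t, k t * (F (x * t) - F x) ∂μ := by
      rw [convOperator_toLp, ← integral_mul_left_eq_self _ x]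
      simp only [inv_mul_cancel_left, mul_sub]
      rw [integral_sub, integral_mul_const, hk1, one_mul]
      · exact hint ⟨fun t => k t * F (x * t), by fun_prop⟩
      · exact hint ⟨fun t => k t * F x, by fun_prop⟩
    rw [h1, ← Real.norm_eq_abs]
    calc ‖∫ t, k t * (F (x * t) - F x) ∂μ‖ ≤ ∫ t, k t * (ε / 2) ∂μ := by
          refine norm_integral_le_of_norm_le (hint ⟨fun t => k t * (ε / 2), by fun_prop⟩)
            (.of_forall fun t => ?_)
          rw [norm_mul, Real.norm_eq_abs, abs_of_nonneg (hk0 t), Real.norm_eq_abs]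
          by_cases ht : t ∈ {t : G | ∀ x, |F (x * t) - F x| ≤ ε / 2}
          · exact mul_le_mul_of_nonneg_left (ht x) (hk0 t)
          · rw [hkV t ht, zero_mul, zero_mul]
      _ = ε / 2 := by rw [integral_mul_const, hk1, one_mul]
  have hdense := ContinuousLinearMap.orthogonalComplement_iSup_eigenspaces_eq_bot
    (isCompactOperator_convOperator μ k) hs
  rw [← Submodule.topologicalClosure_eq_top_iff] at hdense
  have hmem : toL2 F ∈ closure ((⨆ ν, eigenspace (((toL2).comp (convOperator μ k) :
      Lp ℝ 2 μ →L[ℝ] Lp ℝ 2 μ) : Module.End ℝ (Lp ℝ 2 μ)) ν : Submodule ℝ (Lp ℝ 2 μ)) :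
      Set (Lp ℝ 2 μ)) := by
    rw [← Submodule.topologicalClosure_coe, hdense]
    trivial
  obtain ⟨f, hf, hfF⟩ := (mem_closure_iff_nhds.1 hmem) _ ((convOperator μ k).continuous.continuousAt
    (Metric.ball_mem_nhds (convOperator μ k (toL2 F)) (half_pos hε)))
  obtain ⟨W, h1, h2, h3⟩ := exists_isLeftStable_convOperator μ k hfF
  refine ⟨W, h1, h2, _, h3, ?_⟩
  have h4 : ‖convOperator μ k f - convOperator μ k (toL2 F)‖ < ε / 2 := by
    rw [Set.mem_preimage, mem_ball_iff_norm] at hf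
    exact hf
  have h5 : ‖convOperator μ k (toL2 F) - F‖ ≤ ε / 2 := by
    rw [ContinuousMap.norm_le _ (half_pos hε).le]
    exact happrox
  calc _ ≤ _ := norm_sub_le_norm_sub_add_norm_sub _ (convOperator μ k (toL2 F)) _
    _ < ε / 2 + ε / 2 := add_lt_add_of_lt_of_le h4 h5
    _ = ε := add_halves ε

end PeterWeyl

/-! ### Orthogonal representations on spaces of functions -/

section FunctionRep

open MeasureTheory

variable {G : Type} [Group G] [TopologicalSpace G] [IsTopologicalGroup G] [CompactSpace G]
  [T2Space G]

/-- A finite-dimensional left stable space of functions, with the inner product of `L²`, is an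
orthogonal representation. -/
theorem exists_orthogonalRep_of_isLeftStable {V : Type} [NormedAddCommGroup V]
    [InnerProductSpace ℝ V] [FiniteDimensional ℝ V] (W : Submodule ℝ C(G, V))
    [FiniteDimensional ℝ W] (hW : IsLeftStable W) :
    ∃ (S : IPSpace) (ρ : G →* (S ≃ₗᵢ[ℝ] S)) (e : W ≃ₗ[ℝ] S),
      Continuous (fun p : G × S => ρ p.1 p.2) ∧
      ∀ g φ, e ⟨leftTranslate g φ.1, hW g φ.1 φ.2⟩ = ρ g (e φ) := by
  let _ : MeasurableSpace G := borel G
  have : BorelSpace G := ⟨rfl⟩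
  let μ : Measure G := Measure.haar
  let L : C(G, V) →L[ℝ] Lp V 2 μ := ContinuousMap.toLp 2 μ ℝ
  have hL : Function.Injective L := ContinuousMap.toLp_injective μ
  have hnorm : ∀ (g : G) (φ : C(G, V)), ‖L (leftTranslate g φ)‖ = ‖L φ‖ := by
    intro g φ
    rw [Lp.norm_def, Lp.norm_def, eLpNorm_congr_ae (ContinuousMap.coeFn_toLp μ (𝕜 := ℝ) _),
      eLpNorm_congr_ae (ContinuousMap.coeFn_toLp μ (𝕜 := ℝ) φ)]
    congr 1
    exact eLpNorm_comp_measurePreserving φ.continuous.aestronglyMeasurable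
      (measurePreserving_mul_left μ g⁻¹)
  let S : IPSpace := { carrier := W.map (L : C(G, V) →ₗ[ℝ] Lp V 2 μ) }
  let e : W ≃ₗ[ℝ] S := Submodule.equivMapOfInjective (L : C(G, V) →ₗ[ℝ] Lp V 2 μ) hL W
  have he : ∀ φ, ‖e φ‖ = ‖L φ.1‖ := fun φ => rfl
  let t : G → W →ₗ[ℝ] W := fun g => (leftTranslate g).restrict (hW g)
  have ht_one : t 1 = LinearMap.id := by
    ext φ x
    change φ.1 (1⁻¹ * x) = _
    rw [inv_one, one_mul]
    rfl
  have ht_mul : ∀ g h, t (g * h) = (t g).comp (t h) := by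
    intro g h
    ext φ x
    change φ.1 ((g * h)⁻¹ * x) = φ.1 (h⁻¹ * (g⁻¹ * x))
    rw [mul_inv_rev, mul_assoc]
  let r : G → S →ₗᵢ[ℝ] S := fun g =>
    { toLinearMap := (e : W →ₗ[ℝ] S).comp ((t g).comp (e.symm : S →ₗ[ℝ] W))
      norm_map' := fun v => by
        obtain ⟨φ, rfl⟩ := e.surjective v
        change ‖e (t g (e.symm (e φ)))‖ = _
        rw [e.symm_apply_apply, he, he]
        exact hnorm g φ.1 }
  have hr : ∀ g φ, r g (e φ) = e (t g φ) := fun g φ => congrArg (fun ψ => e (t g ψ))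
    (e.symm_apply_apply φ)
  refine ⟨S, isometryHom r ?_ ?_, e, ?_, fun g φ => (hr g φ).symm⟩
  · refine LinearIsometry.ext fun v => ?_
    obtain ⟨φ, rfl⟩ := e.surjective v
    rw [hr, ht_one]
    rfl
  · refine fun g h => LinearIsometry.ext fun v => ?_
    obtain ⟨φ, rfl⟩ := e.surjective v
    change r (g * h) (e φ) = r g (r h (e φ))
    rw [hr, hr, hr, ht_mul]
    rfl
  · -- translation is strongly continuous, and joint continuity follows as it is isometric
    change Continuous (fun p : G × S => r p.1 p.2)
    have he_cont : Continuous e := LinearMap.continuous_of_finiteDimensional (e : W →ₗ[ℝ] S)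
    have hes_cont : Continuous e.symm :=
      LinearMap.continuous_of_finiteDimensional (e.symm : S →ₗ[ℝ] W)
    have h1 : Continuous fun p : G × C(G, V) => leftTranslate p.1 p.2 := by
      refine ContinuousMap.continuous_of_continuous_uncurry _ ?_
      change Continuous fun q : (G × C(G, V)) × G => q.1.2 (q.1.1⁻¹ * q.2)
      fun_prop
    refine he_cont.comp (Continuous.subtype_mk ?_ _)
    exact h1.comp (continuous_fst.prodMk
      (continuous_subtype_val.comp (hes_cont.comp continuous_snd)))

/-- A group has no small subgroups if some neighbourhood of the identity contains no nontrivial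
subgroup. -/
def NoSmallSubgroups (G : Type*) [Group G] [TopologicalSpace G] : Prop :=
  ∃ U ∈ 𝓝 (1 : G), ∀ K : Subgroup G, (K : Set G) ⊆ U → K = ⊥

/-- A compact group without small subgroups has a faithful orthogonal representation: the kernel of
the representation generated by a translation-finite function is contained in each set outside of
which the function differs from its value at the identity. -/
theorem NoSmallSubgroups.exists_injective_rep (h : NoSmallSubgroups G) :
    ∃ (S : IPSpace) (ρ : G →* (S ≃ₗᵢ[ℝ] S)), Continuous (fun p : G × S => ρ p.1 p.2) ∧
      Function.Injective ρ := by
  let _ : MeasurableSpace G := borel G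
  have : BorelSpace G := ⟨rfl⟩
  obtain ⟨U, hU, hK⟩ := h
  obtain ⟨F, hF0, hF1, -⟩ := exists_continuous_zero_one_of_isClosed
    (isClosed_singleton (x := (1 : G))) (isOpen_interior (s := U)).isClosed_compl
    (by rw [Set.disjoint_singleton_left, Set.notMem_compl_iff]; exact mem_interior_iff_mem_nhds.2 hU)
  obtain ⟨W, hfin, hW, φ, hφ, hFφ⟩ := exists_isLeftStable_norm_sub_lt (Measure.haar : Measure G) F
    (ε := 1 / 2) (by norm_num)
  obtain ⟨S, ρ, e, hρ, he⟩ := exists_orthogonalRep_of_isLeftStable W hW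
  refine ⟨S, ρ, hρ, (MonoidHom.ker_eq_bot_iff ρ).1 (hK _ fun g hg => ?_)⟩
  have h1 : φ g = φ 1 := by
    have h2 := he g⁻¹ ⟨φ, hφ⟩
    rw [map_inv, (MonoidHom.mem_ker).1 hg, inv_one] at h2
    have h3 := congrArg (fun ψ : W => ψ.1 1) (e.injective h2)
    simpa using h3
  by_contra hgU
  have h2 : F g = 1 := hF1 fun h => hgU (interior_subset h)
  have h3 : F 1 = 0 := hF0 rfl
  have h4 := (φ - F).norm_coe_le_norm g
  have h5 := (φ - F).norm_coe_le_norm 1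
  rw [ContinuousMap.sub_apply, Real.norm_eq_abs, h2, abs_le] at h4
  rw [ContinuousMap.sub_apply, Real.norm_eq_abs, h3, abs_le] at h5
  linarith [h4.1, h5.2]

end FunctionRep

/-! ### Lie groups have no small subgroups -/

section NoSmallSubgroups

theorem NoSmallSubgroups.subgroup {G : Type*} [Group G] [TopologicalSpace G]
    (h : NoSmallSubgroups G) (H : Subgroup G) : NoSmallSubgroups H := by
  obtain ⟨U, hU, hK⟩ := h
  refine ⟨Subtype.val ⁻¹' U, continuous_subtype_val.continuousAt hU, fun K hKU => ?_⟩
  have h1 := hK (K.map H.subtype) (by rintro _ ⟨k, hk, rfl⟩; exact hKU hk)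
  exact (Subgroup.map_eq_bot_iff_of_injective K H.subtype_injective).1 h1

variable {E : Type*} [NormedAddCommGroup E] [NormedSpace ℝ E] {G : Type*} [Group G]
  [TopologicalSpace G] [ChartedSpace E G] [LieGroup 𝓘(ℝ, E) ∞ G]

/-- In a chart at the identity, squaring has derivative `2`. -/
theorem hasFDerivAt_sq_chart :
    HasFDerivAt (fun x : E => extChartAt 𝓘(ℝ, E) (1 : G)
      ((extChartAt 𝓘(ℝ, E) (1 : G)).symm x * (extChartAt 𝓘(ℝ, E) (1 : G)).symm x))
      ((2 : ℝ) • ContinuousLinearMap.id ℝ E) (extChartAt 𝓘(ℝ, E) (1 : G) 1) := by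
  set φ := extChartAt 𝓘(ℝ, E) (1 : G)
  set x₀ : E := φ 1
  have hsymm : ContMDiffAt 𝓘(ℝ, E) 𝓘(ℝ, E) ∞ φ.symm x₀ :=
    (contMDiffOn_extChartAt_symm (I := 𝓘(ℝ, E)) (n := ∞) (1 : G)).contMDiffAt
      (extChartAt_target_mem_nhds 1)
  have hx₀ : φ.symm x₀ = 1 := extChartAt_to_inv (I := 𝓘(ℝ, E)) (1 : G)
  let m : E × E → E := fun p => φ (φ.symm p.1 * φ.symm p.2)
  have hm : ContDiffAt ℝ ∞ m (x₀, x₀) := by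
    rw [← contMDiffAt_iff_contDiffAt]
    have h1 : ContMDiffAt 𝓘(ℝ, E × E) 𝓘(ℝ, E) ∞ (fun p : E × E => φ.symm p.1) (x₀, x₀) :=
      ContMDiffAt.comp (x₀, x₀) (g := φ.symm) hsymm contDiff_fst.contMDiff.contMDiffAt
    have h2 : ContMDiffAt 𝓘(ℝ, E × E) 𝓘(ℝ, E) ∞ (fun p : E × E => φ.symm p.2) (x₀, x₀) :=
      ContMDiffAt.comp (x₀, x₀) (g := φ.symm) hsymm contDiff_snd.contMDiff.contMDiffAt
    have h3 := h1.mul h2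
    refine ContMDiffAt.comp_of_eq (y := 1) (g := φ) contMDiffAt_extChartAt h3 ?_
    change φ.symm x₀ * φ.symm x₀ = 1
    rw [hx₀, one_mul]
  have hD := (hm.differentiableAt (by simp)).hasFDerivAt
  set D := fderiv ℝ m (x₀, x₀)
  have hleft : D.comp (ContinuousLinearMap.inl ℝ E E) = ContinuousLinearMap.id ℝ E := by
    have h1 : HasFDerivAt (fun x : E => m (x, x₀)) (D.comp (ContinuousLinearMap.inl ℝ E E)) x₀ :=
      HasFDerivAt.comp x₀ (g := m) (f := fun x => (x, x₀)) hD (hasFDerivAt_prodMk_left x₀ x₀)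
    refine h1.unique ((hasFDerivAt_id x₀).congr_of_eventuallyEq ?_)
    filter_upwards [extChartAt_target_mem_nhds (I := 𝓘(ℝ, E)) (1 : G)] with x hx
    change φ (φ.symm x * φ.symm x₀) = x
    rw [hx₀, mul_one]
    exact φ.right_inv hx
  have hright : D.comp (ContinuousLinearMap.inr ℝ E E) = ContinuousLinearMap.id ℝ E := by
    have h1 : HasFDerivAt (fun x : E => m (x₀, x)) (D.comp (ContinuousLinearMap.inr ℝ E E)) x₀ :=
      HasFDerivAt.comp x₀ (g := m) (f := fun x => (x₀, x)) hD (hasFDerivAt_prodMk_right x₀ x₀)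
    refine h1.unique ((hasFDerivAt_id x₀).congr_of_eventuallyEq ?_)
    filter_upwards [extChartAt_target_mem_nhds (I := 𝓘(ℝ, E)) (1 : G)] with x hx
    change φ (φ.symm x₀ * φ.symm x) = x
    rw [hx₀, one_mul]
    exact φ.right_inv hx
  have h1 : HasFDerivAt (fun x : E => m (x, x))
      (D.comp ((ContinuousLinearMap.id ℝ E).prod (ContinuousLinearMap.id ℝ E))) x₀ :=
    HasFDerivAt.comp x₀ (g := m) (f := fun x => (x, x)) hD
      ((hasFDerivAt_id x₀).prodMk (hasFDerivAt_id x₀))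
  convert h1 using 1
  ext u
  have h2 := DFunLike.congr_fun hleft u
  have h3 := DFunLike.congr_fun hright u
  change D (u, 0) = u at h2
  change D (0, u) = u at h3
  change (2 : ℝ) • u = D (u, u)
  have h4 : (u, u) = (u, 0) + (0, u) := by simp
  rw [h4, map_add, h2, h3, two_smul]

/-- A Lie group has no small subgroups: squaring moves points near the identity further away
from it by a definite factor, so that no nontrivial cyclic group stays near the identity. -/
theorem noSmallSubgroups_of_lieGroup (E : Type*) [NormedAddCommGroup E] [NormedSpace ℝ E]
    (G : Type*) [Group G] [TopologicalSpace G] [ChartedSpace E G] [LieGroup 𝓘(ℝ, E) ∞ G] :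
    NoSmallSubgroups G := by
  set φ := extChartAt 𝓘(ℝ, E) (1 : G) with hφ
  have hd := hasFDerivAt_sq_chart (E := E) (G := G)
  rw [← hφ] at hd
  have h1 : φ.symm (φ 1) = 1 := extChartAt_to_inv (I := 𝓘(ℝ, E)) (1 : G)
  have h2 : ∀ᶠ x in 𝓝 (φ 1), (3 / 2 : ℝ) * ‖x - φ 1‖ ≤ ‖φ (φ.symm x * φ.symm x) - φ 1‖ := by
    filter_upwards [hd.isLittleO.def (c := 1 / 2) (by norm_num)] with x hx
    simp only [h1, mul_one, smul_apply, ContinuousLinearMap.id_apply] at hx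
    have h3 := norm_sub_norm_le ((2 : ℝ) • (x - φ 1)) (φ (φ.symm x * φ.symm x) - φ 1)
    rw [norm_smul, Real.norm_ofNat, norm_sub_rev ((2 : ℝ) • (x - φ 1))] at h3
    linarith
  obtain ⟨r, hr, hball⟩ := Metric.eventually_nhds_iff_ball.1 h2
  refine ⟨φ.source ∩ φ ⁻¹' Metric.ball (φ 1) r, Filter.inter_mem (extChartAt_source_mem_nhds 1)
    ((continuousAt_extChartAt 1) (Metric.ball_mem_nhds _ hr)), fun K hK => ?_⟩
  rw [Subgroup.eq_bot_iff_forall]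
  intro g hg
  have hstep : ∀ h ∈ K, (3 / 2 : ℝ) * ‖φ h - φ 1‖ ≤ ‖φ (h * h) - φ 1‖ := by
    intro h hh
    have h3 := hball (φ h) (hK hh).2
    rwa [φ.left_inv (hK hh).1] at h3
  have hpow : ∀ n : ℕ, (3 / 2 : ℝ) ^ n * ‖φ g - φ 1‖ ≤ ‖φ (g ^ 2 ^ n) - φ 1‖ := by
    intro n
    induction n with
    | zero => simp
    | succ n ih =>
      have h3 := hstep (g ^ 2 ^ n) (K.pow_mem hg _)
      rw [← pow_two, ← pow_mul, ← pow_succ] at h3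
      calc _ = (3 / 2 : ℝ) * ((3 / 2) ^ n * ‖φ g - φ 1‖) := by ring
        _ ≤ (3 / 2 : ℝ) * ‖φ (g ^ 2 ^ n) - φ 1‖ := by gcongr
        _ ≤ _ := h3
  have hzero : ‖φ g - φ 1‖ = 0 := by
    by_contra hne
    have hpos : 0 < ‖φ g - φ 1‖ := lt_of_le_of_ne (norm_nonneg _) (Ne.symm hne)
    obtain ⟨n, hn⟩ := pow_unbounded_of_one_lt (r / ‖φ g - φ 1‖) (by norm_num : (1 : ℝ) < 3 / 2)
    rw [div_lt_iff₀ hpos] at hn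
    have h3 := (hK (K.pow_mem hg (2 ^ n))).2
    rw [Set.mem_preimage, mem_ball_iff_norm] at h3
    linarith [hpow n]
  have h3 : φ g = φ 1 := sub_eq_zero.1 (norm_eq_zero.1 hzero)
  exact φ.injOn (hK hg).1 (hK K.one_mem).1 h3

end NoSmallSubgroups

/-! ### One-parameter subgroups of a compact group of operators -/

section OneParameter

open Filter NormedSpace

variable {A : Type*} [NormedRing A] [NormedAlgebra ℝ A] [CompleteSpace A]

theorem exp_smul_pow (X : A) (s : ℝ) (k : ℕ) : exp (s • X) ^ k = exp ((k * s) • X) := by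
  let _ : NormedAlgebra ℚ A := .restrictScalars ℚ ℝ A
  rw [← exp_nsmul, ← smul_smul, Nat.cast_smul_eq_nsmul]

theorem exp_smul_mul_exp_smul (X : A) (s t : ℝ) :
    exp (s • X) * exp (t • X) = exp ((s + t) • X) := by
  let _ : NormedAlgebra ℚ A := .restrictScalars ℚ ℝ A
  rw [add_smul, exp_add_of_commute (((Commute.refl X).smul_left s).smul_right t)]

theorem contDiff_exp_ring {n : WithTop ℕ∞} : ContDiff ℝ n (exp : A → A) :=
  contDiff_iff_contDiffAt.2 fun X => (exp_analytic (𝕂 := ℝ) X).contDiffAt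

theorem hasDerivAt_exp_smul_zero (X : A) : HasDerivAt (fun s : ℝ => exp (s • X)) X 0 := by
  have h1 := hasFDerivAt_exp_zero (𝕂 := ℝ) (𝔸 := A)
  have h2 : HasDerivAt (fun s : ℝ => s • X) X 0 := by
    simpa using (hasDerivAt_id (0 : ℝ)).smul_const X
  rw [← zero_smul ℝ X] at h1
  exact h1.comp_hasDerivAt (0 : ℝ) h2

theorem tendsto_smul_sub_of_hasDerivAt {E : Type*} [NormedAddCommGroup E] [NormedSpace ℝ E]
    {f : ℝ → E} {f' : E} (hf : HasDerivAt f f' 0) {c : ℕ → ℝ} (hc : Tendsto c atTop atTop) :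
    Tendsto (fun n => c n • (f (c n)⁻¹ - f 0)) atTop (𝓝 f') := by
  have h1 : Tendsto (fun n => (c n)⁻¹) atTop (𝓝[≠] 0) := by
    refine tendsto_nhdsWithin_iff.2 ⟨tendsto_inv_atTop_zero.comp hc, ?_⟩
    filter_upwards [hc.eventually_gt_atTop 0] with n hn
    exact inv_ne_zero hn.ne'
  simpa [Function.comp_def] using hf.tendsto_slope_zero.comp h1

theorem norm_pow_sub_pow_le {A : Type*} [NormedRing A] {a b : A} {M : ℝ} {k : ℕ} (ha : ‖a‖ ≤ 1)
    (hb : ∀ i ≤ k, ‖b ^ i‖ ≤ M) : ‖a ^ k - b ^ k‖ ≤ k * M * ‖a - b‖ := by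
  induction k with
  | zero => simp
  | succ k ih =>
    have h1 : a ^ (k + 1) - b ^ (k + 1) = a * (a ^ k - b ^ k) + (a - b) * b ^ k := by
      rw [pow_succ', pow_succ']
      noncomm_ring
    have h2 := ih fun i hi => hb i (hi.trans k.le_succ)
    have h3 := hb k k.le_succ
    calc _ ≤ ‖a‖ * ‖a ^ k - b ^ k‖ + ‖a - b‖ * ‖b ^ k‖ := by
          rw [h1]
          exact (norm_add_le _ _).trans (add_le_add (norm_mul_le _ _) (norm_mul_le _ _))
      _ ≤ 1 * (k * M * ‖a - b‖) + ‖a - b‖ * M := by gcongr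
      _ = _ := by push_cast; ring

variable {H : Type*} [Group H] [TopologicalSpace H] [CompactSpace H]
  (ρ : H →* A)

/-- The directions `X` along which elements of a compact group of operators of norm at most one
approach the identity are tangent to one-parameter subgroups: if `h` is close to `1 + X / c`, then
`exp (t X)` is close to the power `h ^ ⌊t c⌋`. -/
theorem exp_smul_mem_range_of_tendsto (hρ : Continuous ρ) (hρ1 : ∀ h, ‖ρ h‖ ≤ 1) {X : A}
    {c : ℕ → ℝ} {h : ℕ → H} (hc : Tendsto c atTop atTop)
    (hX : Tendsto (fun n => c n • (ρ (h n) - 1)) atTop (𝓝 X)) (t : ℝ) :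
    exp (t • X) ∈ Set.range ρ := by
  let _ : NormedAlgebra ℚ A := .restrictScalars ℚ ℝ A
  have hexp : Continuous fun s : ℝ => exp (s • X) := exp_continuous.comp (by fun_prop)
  have hclosed : IsClosed (Set.range ρ) := (isCompact_range hρ).isClosed
  have hnonneg : ∀ t : ℝ, 0 ≤ t → exp (t • X) ∈ Set.range ρ := by
    intro t ht
    obtain ⟨M, hM⟩ := (isCompact_Icc (a := (0 : ℝ)) (b := t)).exists_bound_of_continuousOn
      hexp.continuousOn
    have hM0 : 0 ≤ M := (norm_nonneg _).trans (hM 0 ⟨le_rfl, ht⟩)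
    -- the rescaled distance between `h n` and `exp (X / c n)` tends to zero
    have hdiff : Tendsto (fun n => c n • (ρ (h n) - exp ((c n)⁻¹ • X))) atTop (𝓝 0) := by
      have h2 : Tendsto (fun n => c n • (exp ((c n)⁻¹ • X) - 1)) atTop (𝓝 X) := by
        simpa using tendsto_smul_sub_of_hasDerivAt (hasDerivAt_exp_smul_zero X) hc
      have h3 := hX.sub h2
      rw [sub_self] at h3
      refine h3.congr fun n => ?_
      rw [← smul_sub]
      congr 1
      abel
    let k : ℕ → ℕ := fun n => ⌊t * c n⌋₊
    have hk : ∀ᶠ n in atTop, 0 < c n ∧ (k n : ℝ) ≤ t * c n := by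
      filter_upwards [hc.eventually_gt_atTop 0] with n hn
      exact ⟨hn, Nat.floor_le (mul_nonneg ht hn.le)⟩
    have hkc : Tendsto (fun n => (k n : ℝ) * (c n)⁻¹) atTop (𝓝 t) := by
      have := (tendsto_nat_floor_mul_div_atTop ht).comp hc
      exact this.congr fun n => by simp [k, div_eq_mul_inv]
    have hlim1 : Tendsto (fun n => exp ((c n)⁻¹ • X) ^ k n) atTop (𝓝 (exp (t • X))) := by
      simp only [exp_smul_pow]
      exact (hexp.tendsto t).comp hkc
    have hlim2 : Tendsto (fun n => ρ (h n ^ k n) - exp ((c n)⁻¹ • X) ^ k n) atTop (𝓝 0) := by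
      have h1 : Tendsto (fun n => t * M * ‖c n • (ρ (h n) - exp ((c n)⁻¹ • X))‖) atTop (𝓝 0) := by
        simpa using hdiff.norm.const_mul (t * M)
      refine squeeze_zero_norm' ?_ h1
      filter_upwards [hk] with n hn
      rw [map_pow]
      refine (norm_pow_sub_pow_le (M := M) (hρ1 (h n)) fun i hi => ?_).trans ?_
      · rw [exp_smul_pow]
        refine hM _ ⟨mul_nonneg i.cast_nonneg (inv_nonneg.2 hn.1.le), ?_⟩
        rw [mul_inv_le_iff₀ hn.1]
        exact (Nat.cast_le.2 hi).trans hn.2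
      · rw [norm_smul, Real.norm_of_nonneg hn.1.le]
        calc _ ≤ (t * c n) * M * ‖ρ (h n) - exp ((c n)⁻¹ • X)‖ := by
              gcongr
              exact hn.2
          _ = _ := by ring
    have hlim := hlim2.add hlim1
    rw [zero_add] at hlim
    refine hclosed.mem_of_tendsto hlim (.of_forall fun n => ⟨h n ^ k n, ?_⟩)
    rw [sub_add_cancel]
  rcases le_total 0 t with ht | ht
  · exact hnonneg t ht
  · obtain ⟨g, hg⟩ := hnonneg (-t) (neg_nonneg.2 ht)
    refine ⟨g⁻¹, ?_⟩
    calc ρ g⁻¹ = ρ g⁻¹ * (exp ((-t) • X) * exp (t • X)) := by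
          rw [exp_smul_mul_exp_smul, neg_add_cancel, zero_smul, exp_zero, mul_one]
      _ = exp (t • X) := by
          rw [← mul_assoc, ← hg, ← map_mul, inv_mul_cancel, map_one, one_mul]

/-- The Lie algebra of a compact group of operators: the generators of its one-parameter
subgroups. -/
def lieSubspace (hρ : Continuous ρ) (hρ1 : ∀ h, ‖ρ h‖ ≤ 1) : Submodule ℝ A where
  carrier := {X | ∀ t : ℝ, exp (t • X) ∈ Set.range ρ}
  zero_mem' t := ⟨1, by rw [smul_zero, exp_zero, map_one]⟩
  smul_mem' c X hX t := by
    rw [smul_smul]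
    exact hX _
  add_mem' := by
    intro X Y hX hY
    -- `X + Y` is the direction of the curve `exp (t X) exp (t Y)` at the identity
    choose x hx using hX
    choose y hy using hY
    let c : ℕ → ℝ := fun n => n + 1
    have hc : Tendsto c atTop atTop := tendsto_atTop_add_const_right _ _ tendsto_natCast_atTop_atTop
    refine exp_smul_mem_range_of_tendsto ρ hρ hρ1 (c := c)
      (h := fun n => x (c n)⁻¹ * y (c n)⁻¹) hc ?_
    have h1 : HasDerivAt (fun s : ℝ => exp (s • X) * exp (s • Y)) (X + Y) 0 := by
      have h2 := (hasDerivAt_exp_smul_zero X).mul (hasDerivAt_exp_smul_zero Y)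
      rw [zero_smul, zero_smul, exp_zero, one_mul, mul_one] at h2
      exact h2
    simpa [hx, hy] using tendsto_smul_sub_of_hasDerivAt h1 hc

end OneParameter

/-! ### Compact groups of operators are Lie groups -/

section LinearLieGroup

open Filter NormedSpace

variable {A : Type} [NormedRing A] [NormedAlgebra ℝ A] [FiniteDimensional ℝ A]
  {H : Type} [Group H] [TopologicalSpace H] [CompactSpace H] (ρ : H →* A)

/-- Elements of the group which differ from the identity by a vector in a fixed complement of the
Lie algebra do not accumulate at the identity: otherwise a limit of their directions would
belong to the Lie algebra. -/
theorem eventually_eq_zero_of_transversal [CompleteSpace A] (hρ : Continuous ρ)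
    (hρ1 : ∀ h, ‖ρ h‖ ≤ 1)
    (π : A →L[ℝ] lieSubspace ρ hρ hρ1) (hπ : ∀ X : lieSubspace ρ hρ hρ1, π X = X) :
    ∀ᶠ Y in 𝓝 (0 : A), π Y = 0 → 1 + Y ∈ Set.range ρ → Y = 0 := by
  by_contra hcon
  rw [not_eventually] at hcon
  obtain ⟨Y, hY0, hY⟩ := exists_seq_forall_of_frequently hcon
  push Not at hY
  have hπY : ∀ n, π (Y n) = 0 := fun n => (hY n).1
  have hne : ∀ n, Y n ≠ 0 := fun n => (hY n).2.2
  choose h hh using fun n => (hY n).2.1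
  have hsphere : ∀ n, ‖Y n‖⁻¹ • Y n ∈ Metric.sphere (0 : A) 1 := by
    intro n
    rw [mem_sphere_zero_iff_norm, norm_smul, norm_inv, norm_norm,
      inv_mul_cancel₀ (norm_ne_zero_iff.2 (hne n))]
  have : ProperSpace A := FiniteDimensional.proper ℝ A
  obtain ⟨u, hu, s, hs, hlim⟩ := (isCompact_sphere (0 : A) 1).tendsto_subseq hsphere
  have hc : Tendsto (fun n => ‖Y (s n)‖⁻¹) atTop atTop := by
    refine tendsto_inv_nhdsGT_zero.comp (tendsto_nhdsWithin_iff.2 ⟨?_, ?_⟩)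
    · simpa using (hY0.comp hs.tendsto_atTop).norm
    · exact .of_forall fun n => norm_pos_iff.2 (hne _)
  have hmem : u ∈ lieSubspace ρ hρ hρ1 := by
    refine exp_smul_mem_range_of_tendsto ρ hρ hρ1 (h := fun n => h (s n)) hc ?_
    refine hlim.congr fun n => ?_
    rw [hh, add_sub_cancel_left]
    rfl
  have hπu : π u = 0 := by
    refine tendsto_nhds_unique ((π.continuous.tendsto u).comp hlim) ?_
    refine tendsto_const_nhds.congr fun n => ?_
    simp [hπY]
  have h1 := hπ ⟨u, hmem⟩
  rw [hπu] at h1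
  have h2 : u = 0 := (congrArg Subtype.val h1).symm
  rw [h2] at hu
  simp at hu

/-- Near the identity, `Ψ Z = exp (π Z) (1 + Z - π Z)` is a local diffeomorphism which straightens
out the group: the elements of the group correspond exactly to the vectors of the Lie algebra. -/
theorem exists_straightening [CompleteSpace A] (hρ : Continuous ρ) (hρ1 : ∀ h, ‖ρ h‖ ≤ 1)
    (π : A →L[ℝ] lieSubspace ρ hρ hρ1) (hπ : ∀ X : lieSubspace ρ hρ hρ1, π X = X) :
    ∃ R : OpenPartialHomeomorph A A, (1 : A) ∈ R.target ∧ R.symm 1 = 0 ∧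
      ContDiffOn ℝ ∞ R.symm R.target ∧
      (∀ X : lieSubspace ρ hρ hρ1, R (X : A) = exp (X : A)) ∧
      ∀ h, ρ h ∈ R.target → (π (R.symm (ρ h)) : A) = R.symm (ρ h) := by
  let _ : NormedAlgebra ℚ A := .restrictScalars ℚ ℝ A
  let P : A →L[ℝ] A := (lieSubspace ρ hρ hρ1).subtypeL.comp π
  let Ψ : A → A := fun Z => exp (P Z) * (1 + (Z - P Z))
  have hPP : ∀ Z, π (P Z) = π Z := fun Z => hπ (π Z)
  have hΨ : ContDiff ℝ ω Ψ :=
    (contDiff_exp_ring.comp P.contDiff).mul (contDiff_const.add (contDiff_id.sub P.contDiff))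
  have hΨ0 : Ψ 0 = 1 := by simp [Ψ, exp_zero]
  have hderiv : HasFDerivAt Ψ ((ContinuousLinearEquiv.refl ℝ A : A ≃L[ℝ] A) : A →L[ℝ] A) 0 := by
    have h1 : HasFDerivAt (fun Z => exp (P Z)) P 0 := by
      have h2 := hasFDerivAt_exp_zero (𝕂 := ℝ) (𝔸 := A)
      rw [← map_zero P] at h2
      exact h2.comp 0 P.hasFDerivAt
    have h2 : HasFDerivAt (fun Z => 1 + (Z - P Z)) (ContinuousLinearMap.id ℝ A - P) 0 :=
      ((hasFDerivAt_id 0).sub P.hasFDerivAt).const_add 1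
    refine (h1.mul' h2).congr_fderiv ?_
    ext Z
    simp [exp_zero]
  let R₀ := hΨ.contDiffAt.toOpenPartialHomeomorph Ψ hderiv (by simp)
  have hR₀ : ∀ Z, R₀ Z = Ψ Z := fun Z => rfl
  have h0 : (0 : A) ∈ R₀.source := hΨ.contDiffAt.mem_toOpenPartialHomeomorph_source hderiv (by simp)
  have h1 : (1 : A) ∈ R₀.target := by
    rw [← hΨ0]
    exact R₀.map_source h0
  have hsymm1 : R₀.symm 1 = 0 := by
    rw [← hΨ0, ← hR₀]
    exact R₀.left_inv h0
  have hsymm : ContDiffAt ℝ ω R₀.symm 1 :=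
    R₀.contDiffAt_symm h1 (by rw [hsymm1]; exact hderiv) hΨ.contDiffAt
  obtain ⟨N, hN, hN_open, hN0⟩ := eventually_nhds_iff.1
    (eventually_eq_zero_of_transversal ρ hρ hρ1 π hπ)
  obtain ⟨T, hT, hT_open, hT1⟩ := eventually_nhds_iff.1 (hsymm.eventually (by simp))
  have hopen : IsOpen ((fun Z => Z - P Z) ⁻¹' N ∩ Ψ ⁻¹' T) :=
    (hN_open.preimage (by fun_prop)).inter (hT_open.preimage hΨ.continuous)
  let R := R₀.restrOpen _ hopen
  have hR : ∀ Z, R Z = Ψ Z := fun Z => rfl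
  have hRsource : ∀ Z ∈ R.source, Z - P Z ∈ N ∧ Ψ Z ∈ T := fun Z hZ => hZ.2
  have h0R : (0 : A) ∈ R.source := by
    refine ⟨h0, ?_, ?_⟩
    · simpa using hN0
    · change Ψ 0 ∈ T
      rwa [hΨ0]
  refine ⟨R, ?_, hsymm1, ?_, fun X => ?_, fun h hh => ?_⟩
  · rw [← hΨ0, ← hR]
    exact R.map_source h0R
  · intro a ha
    have h2 := (hRsource _ (R.map_target ha)).2
    rw [← hR, R.right_inv ha] at h2
    exact ((hT a h2).of_le le_top).contDiffWithinAt
  · rw [hR]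
    change exp (P X) * (1 + ((X : A) - P X)) = _
    have h2 : P X = X := congrArg Subtype.val (hπ X)
    rw [h2, sub_self, add_zero, mul_one]
  · obtain ⟨h2, -⟩ := hRsource _ (R.map_target hh)
    have h3 : Ψ (R.symm (ρ h)) = ρ h := R.right_inv hh
    set Z := R.symm (ρ h)
    have h4 : 1 + (Z - P Z) ∈ Set.range ρ := by
      obtain ⟨g, hg⟩ := (π Z).2 (-1)
      refine ⟨g * h, ?_⟩
      rw [map_mul, hg, ← h3]
      change exp ((-1 : ℝ) • P Z) * (exp (P Z) * _) = _
      have h5 := exp_smul_mul_exp_smul (P Z) (-1) 1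
      rw [one_smul, neg_add_cancel, zero_smul, exp_zero] at h5
      rw [← mul_assoc, h5, one_mul]
    have h5 := hN _ h2 (by rw [map_sub, hPP, sub_self]) h4
    exact (sub_eq_zero.1 h5).symm

end LinearLieGroup

section LinearLieGroup

open Filter NormedSpace

/-- A topological group with a continuous homomorphism `ρ` to a Banach algebra is a Lie group if it
has a chart `φ` at the identity such that `φ` factors over `ρ` through a smooth map, and
`ρ ∘ φ⁻¹` is smooth: the translates of `φ` form a smooth atlas, and a continuous map to the group is
smooth if and only if its composition with `ρ` is. -/
theorem exists_lieGroup_of_chart {A : Type*} [NormedRing A] [NormedAlgebra ℝ A] [CompleteSpace A]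
    {H : Type*} [Group H] [TopologicalSpace H] [IsTopologicalGroup H] (ρ : H →* A)
    {E : Type*} [NormedAddCommGroup E] [NormedSpace ℝ E] (φ : OpenPartialHomeomorph H E)
    (hφ1 : 1 ∈ φ.source) {T : Set A} (hT : IsOpen T) (hsource : φ.source = ρ ⁻¹' T) {τ : A → E}
    (hτ : ContDiffOn ℝ ∞ τ T) (hφτ : ∀ h ∈ φ.source, φ h = τ (ρ h)) {σ : E → A}
    (hσ : ContDiff ℝ ∞ σ) (hφσ : ∀ X ∈ φ.target, ρ (φ.symm X) = σ X) :
    ∃ _ : ChartedSpace E H, LieGroup 𝓘(ℝ, E) ∞ H := by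
  let ch : H → OpenPartialHomeomorph H E := fun g =>
    (Homeomorph.mulLeft g⁻¹).transOpenPartialHomeomorph φ
  have hch_mem : ∀ g h, h ∈ (ch g).source ↔ ρ (g⁻¹ * h) ∈ T := by
    intro g h
    change g⁻¹ * h ∈ φ.source ↔ _
    rw [hsource]
    rfl
  have hch_symm : ∀ g, ∀ X ∈ φ.target, ρ ((ch g).symm X) = ρ g * σ X := by
    intro g X hX
    change ρ (g⁻¹⁻¹ * φ.symm X) = _
    rw [inv_inv, map_mul, hφσ X hX]
  have hch_apply : ∀ g h, h ∈ (ch g).source → ch g h = τ (ρ (g⁻¹ * h)) := fun g h hh => hφτ _ hh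
  have hch_one : ∀ g, g ∈ (ch g).source := by
    intro g
    change g⁻¹ * g ∈ φ.source
    rwa [inv_mul_cancel]
  let cs : ChartedSpace E H :=
    { atlas := Set.range ch
      chartAt := ch
      mem_chart_source := hch_one
      chart_mem_atlas := fun g => ⟨g, rfl⟩ }
  have hmanifold : IsManifold 𝓘(ℝ, E) ∞ H := by
    refine isManifold_of_contDiffOn _ _ _ ?_
    rintro _ _ ⟨g, rfl⟩ ⟨g', rfl⟩
    simp only [modelWithCornersSelf_coe, modelWithCornersSelf_coe_symm, Function.comp_id,
      Function.id_comp, Set.preimage_id, Set.range_id, Set.inter_univ]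
    have h1 : ∀ X ∈ ((ch g).symm.trans (ch g')).source,
        ρ (g'⁻¹ * (ch g).symm X) = ρ (g'⁻¹ * g) * σ X := by
      intro X hX
      rw [map_mul, hch_symm g X hX.1, map_mul, mul_assoc]
    have h2 : ∀ X ∈ ((ch g).symm.trans (ch g')).source,
        ((ch g).symm.trans (ch g')) X = τ (ρ (g'⁻¹ * g) * σ X) := by
      intro X hX
      rw [← h1 X hX]
      exact hch_apply g' _ hX.2
    refine ContDiffOn.congr ?_ h2
    refine hτ.comp (contDiff_const.mul hσ).contDiffOn fun X hX => ?_
    rw [← h1 X hX]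
    exact (hch_mem g' _).1 hX.2
  have hchart : ∀ g : H, extChartAt 𝓘(ℝ, E) g = (ch g).toPartialEquiv := fun g => by
    simp only [mfld_simps]
    rfl
  have hρ_smooth : ContMDiff 𝓘(ℝ, E) 𝓘(ℝ, A) ∞ ρ := by
    intro g
    have h1 : ContMDiffAt 𝓘(ℝ, E) 𝓘(ℝ, A) ∞
        (fun h => ρ g * σ (extChartAt 𝓘(ℝ, E) g h)) g :=
      ContMDiffAt.comp g (g := fun X => ρ g * σ X)
        (contDiff_const.mul hσ).contMDiff.contMDiffAt contMDiffAt_extChartAt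
    refine h1.congr_of_eventuallyEq ?_
    filter_upwards [(ch g).open_source.mem_nhds (hch_one g)] with h hh
    rw [hchart]
    change ρ h = ρ g * σ (ch g h)
    rw [← hch_symm g _ ((ch g).map_source hh), (ch g).left_inv hh]
  have hsmooth : ∀ {E' M : Type _} [NormedAddCommGroup E'] [NormedSpace ℝ E']
      [TopologicalSpace M] {H' : Type _} [TopologicalSpace H'] {I : ModelWithCorners ℝ E' H'}
      [ChartedSpace H' M] (F : M → H), Continuous F →
      ContMDiff I 𝓘(ℝ, A) ∞ (fun x => ρ (F x)) → ContMDiff I 𝓘(ℝ, E) ∞ F := by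
    intro E' M _ _ _ H' _ I _ F hF hρF x
    rw [contMDiffAt_iff_target]
    refine ⟨hF.continuousAt, ?_⟩
    have h1 : ContMDiffAt I 𝓘(ℝ, E) ∞ (fun y => τ (ρ (F x)⁻¹ * ρ (F y))) x := by
      refine ContMDiffAt.comp x (g := fun a => τ (ρ (F x)⁻¹ * a)) (f := fun y => ρ (F y)) ?_
        hρF.contMDiffAt
      refine ContDiffAt.contMDiffAt ?_
      refine ContDiffAt.comp (ρ (F x)) (g := τ) (f := fun a => ρ (F x)⁻¹ * a) ?_
        (contDiffAt_const.mul contDiffAt_id)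
      rw [← map_mul]
      exact hτ.contDiffAt (hT.mem_nhds ((hch_mem (F x) (F x)).1 (hch_one _)))
    refine h1.congr_of_eventuallyEq ?_
    filter_upwards [hF.continuousAt ((ch (F x)).open_source.mem_nhds (hch_one _))] with y hy
    rw [hchart]
    change ch (F x) (F y) = _
    rw [hch_apply _ _ hy, map_mul]
  refine ⟨cs, { hmanifold with contMDiff_mul := ?_, contMDiff_inv := ?_ }⟩
  · refine hsmooth (fun p : H × H => p.1 * p.2) continuous_mul ?_
    simp only [map_mul]
    have h1 : ContMDiff (𝓘(ℝ, E).prod 𝓘(ℝ, E)) 𝓘(ℝ, A × A) ∞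
        (fun p : H × H => (ρ p.1, ρ p.2)) :=
      (hρ_smooth.comp contMDiff_fst).prodMk_space (hρ_smooth.comp contMDiff_snd)
    exact (contDiff_mul (𝕜 := ℝ) (𝔸 := A) (n := ∞)).contMDiff.comp h1
  · refine hsmooth (fun h : H => h⁻¹) continuous_inv fun h => ?_
    have h1 : ∀ h, ρ h⁻¹ = Ring.inverse (ρ h) := by
      intro h
      exact (Ring.inverse_unit (Units.map ρ (toUnits h))).symm
    simp only [h1]
    exact (contDiffAt_ringInverse ℝ (Units.map ρ (toUnits h))).contMDiffAt.comp h
      (f := ρ) hρ_smooth.contMDiffAt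

/-- A compact group with a faithful continuous representation by operators of norm at most one on a
finite-dimensional space is a Lie group. -/
theorem exists_lieGroup_of_injective {A : Type} [NormedRing A] [NormedAlgebra ℝ A]
    [FiniteDimensional ℝ A] {H : Type} [Group H] [TopologicalSpace H] [IsTopologicalGroup H]
    [CompactSpace H] (ρ : H →* A) (hρ : Continuous ρ) (hρ1 : ∀ h, ‖ρ h‖ ≤ 1)
    (hinj : Function.Injective ρ) :
    ∃ (E : Type) (_ : NormedAddCommGroup E) (_ : NormedSpace ℝ E)
      (_ : FiniteDimensional ℝ E) (_ : ChartedSpace E H), LieGroup 𝓘(ℝ, E) ∞ H := by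
  have : CompleteSpace A := FiniteDimensional.complete ℝ A
  obtain ⟨π, hπ⟩ := Submodule.ClosedComplemented.of_finiteDimensional (lieSubspace ρ hρ hρ1)
  obtain ⟨R, hR1, hRsymm1, hRsmooth, hRexp, hR⟩ := exists_straightening ρ hρ hρ1 π hπ
  have hemb := (hρ.isClosedEmbedding hinj).isEmbedding
  have hmem : ∀ X : lieSubspace ρ hρ hρ1, exp (X : A) ∈ Set.range ρ := fun X => by
    simpa using X.2 1
  choose s hs using hmem
  let φ : OpenPartialHomeomorph H (lieSubspace ρ hρ hρ1) :=
    { toFun := fun h => π (R.symm (ρ h))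
      invFun := s
      source := ρ ⁻¹' R.target
      target := Subtype.val ⁻¹' R.source
      map_source' := fun h hh => by
        change ((π (R.symm (ρ h)) : lieSubspace ρ hρ hρ1) : A) ∈ R.source
        rw [hR h hh]
        exact R.map_target hh
      map_target' := fun X hX => by
        change ρ (s X) ∈ R.target
        rw [hs, ← hRexp]
        exact R.map_source hX
      left_inv' := fun h hh => by
        refine hinj ?_
        rw [hs, ← hRexp, hR h hh, R.right_inv hh]
      right_inv' := fun X hX => by
        rw [hs, ← hRexp, R.left_inv hX, hπ]
      open_source := R.open_target.preimage hρ
      open_target := R.open_source.preimage continuous_subtype_val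
      continuousOn_toFun := π.continuous.comp_continuousOn
        (R.continuousOn_symm.comp hρ.continuousOn fun _ h => h)
      continuousOn_invFun := by
        refine Continuous.continuousOn ?_
        rw [hemb.continuous_iff]
        have h1 : ρ ∘ s = fun X : lieSubspace ρ hρ hρ1 => exp (X : A) := funext hs
        rw [h1]
        exact (contDiff_exp_ring (n := 0)).continuous.comp continuous_subtype_val }
  obtain ⟨cs, hcs⟩ := exists_lieGroup_of_chart ρ φ (by change ρ 1 ∈ R.target; rwa [map_one])
    R.open_target rfl (τ := fun a => π (R.symm a)) (π.contDiff.comp_contDiffOn hRsmooth)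
    (fun _ _ => rfl) (σ := fun X => exp (X : A))
    (contDiff_exp_ring.comp (lieSubspace ρ hρ hρ1).subtypeL.contDiff) (fun X _ => hs X)
  exact ⟨lieSubspace ρ hρ hρ1, inferInstance, inferInstance, inferInstance, cs, hcs⟩

/-- A compact group without small subgroups is a Lie group. -/
theorem NoSmallSubgroups.exists_lieGroup {H : Type} [Group H] [TopologicalSpace H]
    [IsTopologicalGroup H] [CompactSpace H] [T2Space H] (h : NoSmallSubgroups H) :
    ∃ (E : Type) (_ : NormedAddCommGroup E) (_ : NormedSpace ℝ E)
      (_ : FiniteDimensional ℝ E) (_ : ChartedSpace E H), LieGroup 𝓘(ℝ, E) ∞ H := by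
  obtain ⟨S, r, hr, hinj⟩ := h.exists_injective_rep
  let ρ : H →* (S →L[ℝ] S) :=
    { toFun := fun h => (r h).toLinearIsometry.toContinuousLinearMap
      map_one' := by rw [map_one]; rfl
      map_mul' := fun g h => by rw [map_mul]; rfl }
  refine exists_lieGroup_of_injective ρ ?_ (fun h => ?_) ?_
  · rw [continuous_clm_apply]
    intro v
    exact hr.comp (Continuous.prodMk_left v)
  · exact (r h).toLinearIsometry.norm_toContinuousLinearMap_le
  · intro g h hgh
    refine hinj (LinearIsometryEquiv.ext fun v => ?_)
    exact DFunLike.congr_fun hgh v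

/-- Closed subgroups of compact Lie groups are Lie groups. -/
theorem CompactLieGroup.exists_lieGroup_subgroup (G : CompactLieGroup) (H : Subgroup G)
    (hH : IsClosed (H : Set G)) :
    ∃ (E : Type) (_ : NormedAddCommGroup E) (_ : NormedSpace ℝ E)
      (_ : FiniteDimensional ℝ E) (_ : ChartedSpace E H), LieGroup 𝓘(ℝ, E) ∞ H := by
  obtain ⟨E, _, _, _, _, _⟩ := G.exists_lieGroup
  have : CompactSpace H := isCompact_iff_compactSpace.1 hH.isCompact
  exact ((noSmallSubgroups_of_lieGroup E G).subgroup H).exists_lieGroup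

/-- A closed subgroup of a compact Lie group, as a compact Lie group. -/
def CompactLieGroup.ofClosedSubgroup (G : CompactLieGroup) (H : Subgroup G)
    (hH : IsClosed (H : Set G)) : CompactLieGroup where
  carrier := H
  compactSpace := isCompact_iff_compactSpace.1 hH.isCompact
  exists_lieGroup := G.exists_lieGroup_subgroup H hH

end LinearLieGroup

/-! ### Representations of closed subgroups embed into restrictions -/

section Restriction

open MeasureTheory
open scoped InnerProductSpace

theorem inner_map_eq_inner_map_inv {K U : Type*} [Group K] [NormedAddCommGroup U]
    [InnerProductSpace ℝ U] (q : K →* (U ≃ₗᵢ[ℝ] U)) (k : K) (u w : U) :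
    ⟪q k u, w⟫_ℝ = ⟪u, q k⁻¹ w⟫_ℝ := by
  rw [← (q k).inner_map_map u, map_inv]
  congr 1
  exact ((q k).apply_symm_apply w).symm

/-- An equivariant surjection `T : S → V` of orthogonal representations gives an equivariant
isometric embedding of `V` into `S`, namely `T* (T T*)^(-1/2)`. Here `(T T*)^(-1/2)` is a polynomial
in `T T*`, and is therefore equivariant. -/
theorem exists_equivariant_isometry {K S V : Type*} [Group K] [NormedAddCommGroup S]
    [InnerProductSpace ℝ S] [FiniteDimensional ℝ S] [NormedAddCommGroup V]
    [InnerProductSpace ℝ V] [FiniteDimensional ℝ V] (r : K →* (V ≃ₗᵢ[ℝ] V))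
    (s : K →* (S ≃ₗᵢ[ℝ] S)) (T : S →ₗ[ℝ] V) (hT : Function.Surjective T)
    (hTr : ∀ k v, T (s k v) = r k (T v)) :
    ∃ ψ : V →ₗᵢ[ℝ] S, ∀ k v, ψ (r k v) = s k (ψ v) := by
  classical
  let T' : V →ₗ[ℝ] S := LinearMap.adjoint T
  have hadj : ∀ v w, ⟪T' v, w⟫_ℝ = ⟪v, T w⟫_ℝ := fun v w => LinearMap.adjoint_inner_left T w v
  have hT'r : ∀ k v, T' (r k v) = s k (T' v) := by
    intro k v
    refine ext_inner_right ℝ fun w => ?_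
    rw [hadj, inner_map_eq_inner_map_inv, ← hTr, ← hadj, ← inner_map_eq_inner_map_inv]
  let N : V →ₗ[ℝ] V := T ∘ₗ T'
  have hN : ∀ v w, ⟪T' v, T' w⟫_ℝ = ⟪v, N w⟫_ℝ := fun v w => hadj v (T' w)
  have hNsymm : N.IsSymmetric := by
    intro v w
    rw [← hN, real_inner_comm, ← hN, real_inner_comm]
  have hNr : ∀ k v, N (r k v) = r k (N v) := by
    intro k v
    change T (T' _) = _
    rw [hT'r, hTr]
    rfl
  have hT'inj : ∀ v, T' v = 0 → v = 0 := by
    intro v hv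
    obtain ⟨w, hw⟩ := hT v
    have h1 := hadj v w
    rw [hv, inner_zero_left, hw] at h1
    exact inner_self_eq_zero.1 h1.symm
  let b := hNsymm.eigenvectorBasis rfl
  let l := hNsymm.eigenvalues rfl
  have hb : ∀ i, N (b i) = l i • b i := hNsymm.apply_eigenvectorBasis rfl
  have hl : ∀ i, 0 < l i := by
    intro i
    have h1 : ⟪T' (b i), T' (b i)⟫_ℝ = l i := by
      rw [hN, hb, inner_smul_right, real_inner_self_eq_norm_sq, b.norm_eq_one]
      simp
    rw [← h1, real_inner_self_pos]
    intro h2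
    have h3 := b.norm_eq_one i
    rw [hT'inj _ h2, norm_zero] at h3
    exact zero_ne_one h3
  let p : Polynomial ℝ := Lagrange.interpolate (Finset.univ.image l) id fun x => (Real.sqrt x)⁻¹
  have hp : ∀ i, p.eval (l i) = (Real.sqrt (l i))⁻¹ := fun i =>
    Lagrange.eval_interpolate_at_node (v := id) _ (Set.injOn_id _)
      (Finset.mem_image_of_mem l (Finset.mem_univ i))
  let B : Module.End ℝ V := Polynomial.aeval (N : Module.End ℝ V) p
  have hB : ∀ i, B (b i) = (Real.sqrt (l i))⁻¹ • b i := by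
    intro i
    rw [← hp]
    refine Module.End.aeval_apply_of_hasEigenvector ⟨?_, ?_⟩
    · exact Module.End.mem_eigenspace_iff.2 (hb i)
    · intro h
      have h3 := b.norm_eq_one i
      rw [h, norm_zero] at h3
      exact zero_ne_one h3
  have hBr : ∀ k v, B (r k v) = r k (B v) := by
    intro k v
    have h1 : Commute (N : Module.End ℝ V) ((r k).toLinearEquiv : V →ₗ[ℝ] V) := by
      ext v
      exact hNr k v
    have h2 : Commute B ((r k).toLinearEquiv : V →ₗ[ℝ] V) := by
      change Commute (Polynomial.aeval (N : Module.End ℝ V) p) _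
      rw [Polynomial.aeval_eq_sum_range]
      exact Commute.sum_left _ _ _ fun j _ => (h1.pow_left j).smul_left _
    exact DFunLike.congr_fun h2 v
  have horth : Orthonormal ℝ ((T' ∘ₗ B) ∘ b.toBasis) := by
    rw [orthonormal_iff_ite]
    intro i j
    change ⟪T' (B (b.toBasis i)), T' (B (b.toBasis j))⟫_ℝ = _
    rw [b.coe_toBasis, hB, hB, map_smul, map_smul, inner_smul_left, inner_smul_right, hN, hb,
      inner_smul_right, orthonormal_iff_ite.1 b.orthonormal]
    split_ifs with hij
    · subst hij
      have h1 := Real.mul_self_sqrt (hl i).le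
      have h2 := Real.sqrt_pos.2 (hl i)
      simp only [conj_trivial, mul_one]
      field_simp
      linarith
    · simp
  refine ⟨LinearMap.isometryOfOrthonormal (T' ∘ₗ B) (v := b.toBasis) (by simp [b.orthonormal]) horth,
    fun k v => ?_⟩
  change T' (B (r k v)) = s k (T' (B v))
  rw [hBr, hT'r]

/-- Let `i : K → G` be the inclusion of a compact subgroup. Every orthogonal representation `r` of
`K` embeds into the restriction of an orthogonal representation of `G`. The representation of `G` is
a space of `V`-valued functions, which is mapped to `V` by `ψ ↦ ∫ r(h) ψ(h) dh`. This map is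
surjective if the space contains the functions `φ • v`, for a real-valued function `φ` which is
concentrated near the identity. -/
theorem exists_rep_embedding {K G : Type} [Group K] [TopologicalSpace K] [IsTopologicalGroup K]
    [CompactSpace K] [T2Space K] [Group G] [TopologicalSpace G] [IsTopologicalGroup G]
    [CompactSpace G] [T2Space G] (i : K →* G) (hi : Topology.IsEmbedding i) {V : Type}
    [NormedAddCommGroup V] [InnerProductSpace ℝ V] [FiniteDimensional ℝ V]
    (r : K →* (V ≃ₗᵢ[ℝ] V)) (hr : Continuous fun p : K × V => r p.1 p.2) :
    ∃ (S : IPSpace) (ρ : G →* (S ≃ₗᵢ[ℝ] S)) (ψ : V →ₗᵢ[ℝ] S),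
      Continuous (fun p : G × S => ρ p.1 p.2) ∧ ∀ k v, ψ (r k v) = ρ (i k) (ψ v) := by
  let _ : MeasurableSpace G := borel G
  have : BorelSpace G := ⟨rfl⟩
  let _ : MeasurableSpace K := borel K
  have : BorelSpace K := ⟨rfl⟩
  let ν : Measure K := Measure.haar
  have hint : ∀ {E : Type} [NormedAddCommGroup E] {f : K → E}, Continuous f → Integrable f ν :=
    fun hf => hf.integrable_of_hasCompactSupport (HasCompactSupport.of_compactSpace _)
  have hrc : ∀ f : C(G, V), Continuous fun h => r h (f (i h)) := fun f =>
    hr.comp (continuous_id.prodMk (f.continuous.comp hi.continuous))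
  -- the averaging map
  let I : C(G, V) →ₗ[ℝ] V :=
    { toFun := fun f => ∫ h, r h (f (i h)) ∂ν
      map_add' := fun f g => by
        simp only [ContinuousMap.add_apply, map_add]
        exact integral_add (hint (hrc f)) (hint (hrc g))
      map_smul' := fun c f => by
        simp only [ContinuousMap.smul_apply, map_smul]
        exact integral_smul c _ }
  have hI : ∀ k f, I (leftTranslate (i k) f) = r k (I f) := by
    intro k f
    change ∫ h, r h (f ((i k)⁻¹ * i h)) ∂ν = r k (∫ h, r h (f (i h)) ∂ν)
    change _ = (r k).toLinearIsometry.toContinuousLinearMap (∫ h, r h (f (i h)) ∂ν)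
    rw [← ContinuousLinearMap.integral_comp_comm _ (hint (hrc f)),
      ← integral_mul_left_eq_self _ k]
    simp only [map_mul, inv_mul_cancel_left]
    rfl
  -- a bump function near the identity
  have hnear : {h : K | ∀ v, ‖r h v - v‖ ≤ 1 / 2 * ‖v‖} ∈ 𝓝 (1 : K) := by
    let D : K → V →L[ℝ] V := fun h => (r h).toLinearIsometry.toContinuousLinearMap
    have hD : Continuous D := continuous_clm_apply.2 fun v => hr.comp (Continuous.prodMk_left v)
    filter_upwards [hD.continuousAt (Metric.closedBall_mem_nhds (D 1) (one_half_pos (α := ℝ)))]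
      with h hh v
    rw [Set.mem_preimage, mem_closedBall_iff_norm] at hh
    have h1 := (D h - D 1).le_of_opNorm_le hh v
    have h2 : D 1 v = v := by
      change r 1 v = v
      rw [map_one]
      rfl
    rw [sub_apply, h2] at h1
    exact h1
  rw [hi.nhds_eq_comap, map_one] at hnear
  obtain ⟨U, hU, hUK⟩ := hnear
  obtain ⟨F, hF0, hF1, hF⟩ := exists_continuous_zero_one_of_isClosed
    (isOpen_interior (s := U)).isClosed_compl (isClosed_singleton (x := (1 : G)))
    (by rw [Set.disjoint_singleton_right, Set.notMem_compl_iff]; exact mem_interior_iff_mem_nhds.2 hU)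
  have hFi : Continuous fun h => F (i h) := F.continuous.comp hi.continuous
  let c : ℝ := ∫ h, F (i h) ∂ν
  have hc : 0 < c := by
    refine hFi.integral_pos_of_hasCompactSupport_nonneg_nonzero
      (HasCompactSupport.of_compactSpace _) (fun h => (hF (i h)).1) (x := 1) ?_
    rw [map_one, hF1 rfl]
    simp
  have hν : 0 ≤ ν.real Set.univ := measureReal_nonneg
  obtain ⟨W, _, hW, φ, hφ, hFφ⟩ := exists_isLeftStable_norm_sub_lt (Measure.haar : Measure G) F
    (ε := c / (4 * (ν.real Set.univ + 1))) (by positivity)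
  -- the space of vector-valued functions
  let sm : C(G, ℝ) →ₗ[ℝ] V →ₗ[ℝ] C(G, V) := LinearMap.mk₂ ℝ
    (fun f v => ⟨fun x => f x • v, by fun_prop⟩)
    (fun f g v => by ext x; exact add_smul _ _ _) (fun a f v => by ext x; exact mul_smul _ _ _)
    (fun f v w => by ext x; exact smul_add _ _ _) (fun a f v => by ext x; exact smul_comm _ _ _)
  let WV : Submodule ℝ C(G, V) := Submodule.map₂ sm W ⊤
  have hWV_fin : FiniteDimensional ℝ WV := by
    exact Module.Finite.iff_fg.2 ((Module.Finite.iff_fg.1 inferInstance).map₂ sm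
      (Module.Finite.iff_fg.1 inferInstance))
  have hWV : IsLeftStable WV := by
    intro g
    change WV ≤ WV.comap (leftTranslate g)
    refine Submodule.map₂_le.2 fun f hf v _ => ?_
    exact Submodule.apply_mem_map₂ sm (hW g f hf) (Submodule.mem_top (x := v))
  obtain ⟨S, ρ, e, hρ, he⟩ := exists_orthogonalRep_of_isLeftStable WV hWV
  have hsmall : ∀ v, ‖I (sm φ v) - c • v‖ ≤ 3 / 4 * c * ‖v‖ := by
    intro v
    have h1 : I (sm φ v) - c • v = (∫ h, (φ (i h) - F (i h)) • r h v ∂ν) +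
        ∫ h, F (i h) • (r h v - v) ∂ν := by
      have hcont : Continuous fun h => r h v := hr.comp (Continuous.prodMk_left v)
      have hφi : Continuous fun h => φ (i h) := φ.continuous.comp hi.continuous
      have h2 : Integrable (fun h => r h (φ (i h) • v)) ν := hint (hrc (sm φ v))
      change (∫ h, r h (φ (i h) • v) ∂ν) - (∫ h, F (i h) ∂ν) • v = _
      rw [← integral_add (hint (by fun_prop)) (hint (by fun_prop)), ← integral_smul_const,
        ← integral_sub h2 (hint (by fun_prop))]
      refine integral_congr_ae (.of_forall fun h => ?_)
      simp only [map_smul]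
      module
    have h2 : ‖∫ h, (φ (i h) - F (i h)) • r h v ∂ν‖ ≤ 1 / 4 * c * ‖v‖ := by
      have h3 : ‖∫ h, (φ (i h) - F (i h)) • r h v ∂ν‖ ≤
          (c / (4 * (ν.real Set.univ + 1)) * ‖v‖) * ν.real Set.univ := by
        refine norm_integral_le_of_norm_le_const (.of_forall fun h => ?_)
        rw [norm_smul, (r h).norm_map]
        gcongr
        exact ((φ - F).norm_coe_le_norm (i h)).trans hFφ.le
      refine h3.trans ?_
      rw [div_mul_eq_mul_div, div_mul_eq_mul_div, div_le_iff₀ (by positivity)]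
      nlinarith [mul_nonneg hc.le (norm_nonneg v)]
    have h3 : ‖∫ h, F (i h) • (r h v - v) ∂ν‖ ≤ 1 / 2 * c * ‖v‖ := by
      have h4 : ‖∫ h, F (i h) • (r h v - v) ∂ν‖ ≤ ∫ h, F (i h) * (1 / 2 * ‖v‖) ∂ν := by
        refine norm_integral_le_of_norm_le (hint (by fun_prop)) (.of_forall fun h => ?_)
        rw [norm_smul, Real.norm_of_nonneg (hF (i h)).1]
        by_cases hh : i h ∈ U
        · exact mul_le_mul_of_nonneg_left (hUK hh v) (hF (i h)).1
        · rw [hF0 fun h' => hh (interior_subset h')]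
          simp
      rw [integral_mul_const] at h4
      linarith
    rw [h1]
    linarith [norm_add_le (∫ h, (φ (i h) - F (i h)) • r h v ∂ν) (∫ h, F (i h) • (r h v - v) ∂ν)]
  have hMinj : Function.Injective (I ∘ₗ sm φ) := by
    rw [injective_iff_map_eq_zero]
    intro v hv
    have h1 := hsmall v
    change I (sm φ v) = 0 at hv
    rw [hv, zero_sub, norm_neg, norm_smul, Real.norm_of_nonneg hc.le] at h1
    by_contra hne
    have h2 := mul_pos hc (norm_pos_iff.2 hne)
    linarith
  have hMsurj : Function.Surjective (I ∘ₗ sm φ) := LinearMap.injective_iff_surjective.1 hMinj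
  obtain ⟨ψ, hψ⟩ := exists_equivariant_isometry r (ρ.comp i)
    (I ∘ₗ WV.subtype ∘ₗ (e.symm : S →ₗ[ℝ] WV)) (fun v => by
      obtain ⟨w, rfl⟩ := hMsurj v
      refine ⟨e ⟨sm φ w, Submodule.apply_mem_map₂ sm hφ (Submodule.mem_top (x := w))⟩, ?_⟩
      simp)
    (fun k v => by
      obtain ⟨f, rfl⟩ := e.surjective v
      change I (e.symm (ρ (i k) (e f))) = r k (I (e.symm (e f)))
      rw [← he, e.symm_apply_apply, e.symm_apply_apply]
      exact hI k f.1)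
  exact ⟨S, ρ, ψ, hρ, hψ⟩

/-- Every representation of a closed subgroup embeds into the restriction of a representation of the
whole group. -/
theorem OrthRep.exists_embedding_restriction {G : CompactLieGroup} (H : Subgroup G)
    (hH : IsClosed (H : Set G)) (V : OrthRep (G.ofClosedSubgroup H hH)) :
    ∃ (W : OrthRep G) (ψ : V.space →ₗᵢ[ℝ] W.space), ∀ (h : H) (v : V.space),
      ψ (V.ρ h v) = W.ρ (h : G) (ψ v) := by
  have : CompactSpace H := isCompact_iff_compactSpace.1 hH.isCompact
  obtain ⟨S, ρ, ψ, hρ, hψ⟩ := exists_rep_embedding (K := H) (G := G)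
    H.subtype Topology.IsEmbedding.subtypeVal V.ρ V.continuous_ρ
  exact ⟨⟨S, ρ, hρ⟩, ψ, hψ⟩

end Restriction

/-! ### Graph subgroups and fixed points -/

section Graph

variable {G : CompactLieGroup} {n : ℕ}

/-- The projection of a graph subgroup to `G` is closed. -/
theorem IsGraphSubgroup.isClosed_map_fst {Γ : Subgroup (G × Equiv.Perm (Fin n))}
    (hΓ : IsGraphSubgroup Γ) :
    IsClosed (Γ.map (MonoidHom.fst G (Equiv.Perm (Fin n))) : Set G) := by
  let _ : TopologicalSpace (Equiv.Perm (Fin n)) := ⊥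
  have : DiscreteTopology (Equiv.Perm (Fin n)) := ⟨rfl⟩
  have h : IsClosed (Γ : Set (G × Equiv.Perm (Fin n))) := hΓ.1
  exact (h.isCompact.image continuous_fst).isClosed

/-- A graph subgroup is the graph of a locally constant homomorphism defined on its projection
to `G`. -/
theorem IsGraphSubgroup.exists_hom {Γ : Subgroup (G × Equiv.Perm (Fin n))}
    (hΓ : IsGraphSubgroup Γ) :
    ∃ φ : Γ.map (MonoidHom.fst G (Equiv.Perm (Fin n))) →* Equiv.Perm (Fin n),
      IsLocallyConstant φ ∧ (∀ h : Γ.map (MonoidHom.fst G (Equiv.Perm (Fin n))), ((h : G), φ h) ∈ Γ) ∧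
      ∀ γ (hγ : γ ∈ Γ), φ ⟨γ.1, Subgroup.mem_map_of_mem _ hγ⟩ = γ.2 := by
  have huniq : ∀ (g : G) (σ τ : Equiv.Perm (Fin n)), (g, σ) ∈ Γ → (g, τ) ∈ Γ → σ = τ := by
    intro g σ τ hσ hτ
    have h := Γ.mul_mem hσ (Γ.inv_mem hτ)
    rw [Prod.inv_mk, Prod.mk_mul_mk, mul_inv_cancel] at h
    exact mul_inv_eq_one.1 (hΓ.2 _ h)
  have hex : ∀ h : Γ.map (MonoidHom.fst G (Equiv.Perm (Fin n))), ∃ σ, ((h : G), σ) ∈ Γ := by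
    rintro ⟨_, ⟨g, σ⟩, hγ, rfl⟩
    exact ⟨σ, hγ⟩
  choose s hs using hex
  refine ⟨MonoidHom.mk' s fun a b => huniq _ _ _ (hs _) (Γ.mul_mem (hs a) (hs b)), ?_, hs,
    fun γ hγ => huniq _ _ _ (hs _) hγ⟩
  have hclosed : ∀ σ, IsClosed (s ⁻¹' {σ}) := by
    intro σ
    let _ : TopologicalSpace (Equiv.Perm (Fin n)) := ⊥
    have h : IsClosed (Γ : Set (G × Equiv.Perm (Fin n))) := hΓ.1
    have h1 : s ⁻¹' {σ} = (fun h : Γ.map (MonoidHom.fst G (Equiv.Perm (Fin n))) => ((h : G), σ)) ⁻¹' (Γ : Set (G × Equiv.Perm (Fin n))) := by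
      ext h
      constructor
      · rintro rfl
        exact hs h
      · intro h'
        exact huniq _ _ _ (hs h) h'
    rw [h1]
    exact h.preimage (by fun_prop)
  rw [IsLocallyConstant.iff_isOpen_fiber]
  intro σ
  have h1 : s ⁻¹' {σ} = (⋃ τ ∈ {τ | τ ≠ σ}, s ⁻¹' {τ})ᶜ := by
    ext h
    simp only [Set.mem_preimage, Set.mem_singleton_iff, Set.mem_compl_iff, Set.mem_iUnion,
      Set.mem_ofPred_eq, not_exists]
    exact ⟨fun h τ hτ h' => hτ (h'.symm.trans h), fun h' => not_not.1 fun hne => h' _ hne rfl⟩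
  change IsOpen (s ⁻¹' {σ})
  rw [h1, isOpen_compl_iff]
  exact Set.Finite.isClosed_biUnion (Set.toFinite _) fun τ _ => hclosed τ

/-- A graph subgroup `Γ` over `H ≤ G` has a fixed point if and only if the corresponding
homomorphism from `H` has one: representations of `H` embed into restrictions of representations
of `G`. -/
theorem SymmSeq.exists_fixedPoints_nonempty_iff (M : SymmSeq.{u})
    {Γ : Subgroup (G × Equiv.Perm (Fin n))} (hΓ : IsGraphSubgroup Γ)
    (φ : G.ofClosedSubgroup _ hΓ.isClosed_map_fst →* Equiv.Perm (Fin n))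
    (hφ : ∀ h : Γ.map (MonoidHom.fst G (Equiv.Perm (Fin n))), ((h : G), φ h) ∈ Γ)
    (hφ' : ∀ γ (hγ : γ ∈ Γ), φ ⟨γ.1, Subgroup.mem_map_of_mem _ hγ⟩ = γ.2) :
    (∃ V : OrthRep G, (M.fixedPoints Γ V).Nonempty) ↔ M.HasFixedPoint φ := by
  constructor
  · rintro ⟨V, x, hx⟩
    refine ⟨⟨V.space, V.ρ.comp (Subgroup.subtype _), ?_⟩, x, fun h => hx _ (hφ h)⟩
    exact V.continuous_ρ.comp ((continuous_subtype_val.comp continuous_fst).prodMk continuous_snd)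
  · rintro ⟨V, x, hx⟩
    obtain ⟨W, ψ, hψ⟩ := OrthRep.exists_embedding_restriction _ _ V
    refine ⟨W, (M.space n).map ψ x, fun γ hγ => ?_⟩
    have h1 := hx ⟨γ.1, Subgroup.mem_map_of_mem _ hγ⟩
    conv_rhs => rw [← h1]
    rw [← M.map_smul, ← OrthSpace.map_comp, ← OrthSpace.map_comp, hφ' γ hγ]
    congr 1
    ext v
    exact (hψ ⟨γ.1, Subgroup.mem_map_of_mem _ hγ⟩ v).symm

/-- The homomorphism to `Σₙ` which describes a `G`-set with elements ordered by `a`. -/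
def permHom {A : Type} [MulAction G A] (a : A ≃ Fin n) : G →* Equiv.Perm (Fin n) :=
  (a.permCongrHom : Equiv.Perm A →* Equiv.Perm (Fin n)).comp (MulAction.toPermHom G A)

theorem permHom_apply {A : Type} [MulAction G A] (a : A ≃ Fin n) (g : G) (x : A) :
    permHom a g (a x) = a (g • x) := by
  simp [permHom, Equiv.permCongr_apply]

theorem mem_graphOfSet_iff {A : Type} [MulAction G A] (a : A ≃ Fin n)
    (γ : G × Equiv.Perm (Fin n)) : γ ∈ graphOfSet a ↔ γ.2 = permHom a γ.1 := by
  constructor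
  · intro h
    ext i
    obtain ⟨x, rfl⟩ := a.surjective i
    rw [h x, permHom_apply]
  · intro h x
    rw [h, permHom_apply]

theorem isGraphSubgroup_graphOfSet {K : Subgroup G} (hK : IsClosed (K : Set G))
    (a : (G ⧸ K) ≃ Fin n) : IsGraphSubgroup (graphOfSet (H := G) a) := by
  constructor
  · let _ : TopologicalSpace (Equiv.Perm (Fin n)) := ⊥
    have : DiscreteTopology (Equiv.Perm (Fin n)) := ⟨rfl⟩
    have h1 : ((graphOfSet (H := G) a : Subgroup (G × Equiv.Perm (Fin n))) :
        Set (G × Equiv.Perm (Fin n))) =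
        ⋃ σ : Equiv.Perm (Fin n), ⋂ x : G, {γ | γ.2 = σ} ∩
          {γ | (a.symm (σ (a x)) : G ⧸ K).out⁻¹ * (γ.1 * x) ∈ K} := by
      ext γ
      simp only [Set.mem_iUnion, Set.mem_iInter]
      have h2 : ∀ (σ : Equiv.Perm (Fin n)) (x : G),
          ((a.symm (σ (a x)) : G ⧸ K).out⁻¹ * (γ.1 * x) ∈ K) ↔
            σ (a (x : G ⧸ K)) = a (γ.1 • (x : G ⧸ K)) := by
        intro σ x
        rw [← QuotientGroup.eq, QuotientGroup.out_eq', Equiv.symm_apply_eq]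
        rfl
      constructor
      · intro h
        exact ⟨γ.2, fun x => ⟨rfl, (h2 _ _).2 (h x)⟩⟩
      · rintro ⟨σ, h⟩ x
        obtain ⟨x, rfl⟩ := QuotientGroup.mk_surjective x
        obtain ⟨h3, h4⟩ := h x
        rw [h3]
        exact (h2 _ _).1 h4
    rw [h1]
    refine isClosed_iUnion_of_finite fun σ => isClosed_iInter fun x => IsClosed.inter ?_ ?_
    · exact (isClosed_discrete {σ}).preimage continuous_snd
    · exact hK.preimage (by fun_prop)
  · intro σ h
    rw [mem_graphOfSet_iff] at h
    simpa using h

/-- The graph of the action on `G / K` is admissible if and only if this `G`-set has a fixed point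
in `M`. -/
theorem SymmSeq.admissible_graphOfSet_iff (M : SymmSeq.{u}) {K : Subgroup G}
    (hK : IsClosed (K : Set G)) (a : (G ⧸ K) ≃ Fin n) :
    M.Admissible G n (graphOfSet (H := G) a) ↔ M.HasFixedPoint (permHom (G := G) a) := by
  constructor
  · rintro ⟨-, V, x, hx⟩
    exact ⟨V, x, fun g => hx (g, permHom a g) ((mem_graphOfSet_iff _ _).2 rfl)⟩
  · rintro ⟨V, x, hx⟩
    refine ⟨isGraphSubgroup_graphOfSet hK a, V, x, fun γ hγ => ?_⟩
    rw [(mem_graphOfSet_iff _ _).1 hγ]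
    exact hx γ.1

end Graph

/-! ### Admissibility is determined by transfers -/

section Transfers

/-- An action `φ` on `Fin m` decomposes into orbits, which are of the form `H / K`. If `φ` has a
fixed point in `P` then so has every orbit, so that `K ≤ H` is a transfer of `P`. If these are
transfers of `O`, then the disjoint union of the orbits has a fixed point in `O`. -/
theorem Operad.hasFixedPoint_of_transfers {O P : Operad.{u}}
    (hO : ∀ n, (O.space n).IsNonempty) (hP : (P.space 0).IsNonempty) {H : CompactLieGroup}
    (hOP : ∀ K, P.transfers H K → O.transfers H K) {m : ℕ} (φ : H →* Equiv.Perm (Fin m))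
    (hφ : IsLocallyConstant φ) (h : P.HasFixedPoint φ) : O.HasFixedPoint φ := by
  classical
  let _ : MulAction H (Fin m) := MulAction.compHom _ φ
  let Ω := MulAction.orbitRel.Quotient H (Fin m)
  let _ : Fintype Ω := Fintype.ofFinite _
  let k := Fintype.card Ω
  let b : Fin k ≃ Ω := (Fintype.equivFin Ω).symm
  let K : Fin k → Subgroup H := fun i => MulAction.stabilizer H (b i).out
  have hKclosed : ∀ i, IsClosed (K i : Set H) := by
    intro i
    exact isOpen_compl_iff.1 (hφ {σ | σ (b i).out ≠ (b i).out})
  have hKindex : ∀ i, (K i).FiniteIndex := by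
    intro i
    have : Finite (H ⧸ K i) := Finite.of_injective _ (MulAction.injective_ofQuotientStabilizer H (b i).out)
    exact Subgroup.finiteIndex_of_finite_quotient
  have htr : ∀ i, O.transfers H (K i) := by
    intro i
    refine hOP _ ⟨hKclosed i, hKindex i, ?_⟩
    have := hKindex i
    have : Finite (H ⧸ K i) := Subgroup.finite_quotient_of_finiteIndex
    let a : (H ⧸ K i) ≃ Fin (K i).index := Finite.equivFinOfCardEq rfl
    refine ⟨a, (SymmSeq.admissible_graphOfSet_iff _ (hKclosed i) a).2 ?_⟩
    refine P.hasFixedPoint_of_embedding φ (permHom a)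
      ⟨fun j => MulAction.ofQuotientStabilizer H (b i).out (a.symm j),
        (MulAction.injective_ofQuotientStabilizer H (b i).out).comp a.symm.injective⟩ ?_ hφ hP h
    intro g j
    obtain ⟨x, rfl⟩ := a.surjective j
    rw [permHom_apply]
    simp only [Function.Embedding.coeFn_mk, Equiv.symm_apply_apply]
    rw [MulAction.ofQuotientStabilizer_smul]
    rfl
  choose _ _ a ha using htr
  let F : (Σ i, Fin (K i).index) → Fin m := fun p =>
    MulAction.ofQuotientStabilizer H (b p.1).out ((a p.1).symm p.2)
  have hF : Function.Bijective F := by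
    have horbit : ∀ p, (Quotient.mk _ (F p) : Ω) = b p.1 := by
      intro p
      rw [← Quotient.out_eq (b p.1)]
      exact Quotient.sound (MulAction.ofQuotientStabilizer_mem_orbit H _ _)
    constructor
    · rintro ⟨i, j⟩ ⟨i', j'⟩ hij
      obtain rfl : i = i' := b.injective (by
        rw [← horbit ⟨i, j⟩, ← horbit ⟨i', j'⟩, hij])
      have h1 : j = j' := (a i).symm.injective (MulAction.injective_ofQuotientStabilizer H (b i).out hij)
      rw [h1]
    · intro x
      have h1 : x ∈ MulAction.orbit H (b (b.symm (Quotient.mk _ x : Ω))).out := by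
        rw [Equiv.apply_symm_apply]
        exact MulAction.orbitRel_apply.1 (Quotient.exact (Quotient.out_eq (Quotient.mk _ x : Ω)).symm)
      obtain ⟨g, hg⟩ := h1
      refine ⟨⟨b.symm (Quotient.mk _ x : Ω), a _ (g : H ⧸ K _)⟩, ?_⟩
      change MulAction.ofQuotientStabilizer H _ ((a _).symm (a _ _)) = x
      rw [Equiv.symm_apply_apply, MulAction.ofQuotientStabilizer_mk]
      exact hg
  refine O.hasFixedPoint_of_sigma φ (Equiv.ofBijective F hF) (fun i => permHom (a i)) ?_ (hO k)
    fun i => (SymmSeq.admissible_graphOfSet_iff _ (hKclosed i) (a i)).1 (ha i)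
  intro g i j
  obtain ⟨x, rfl⟩ := (a i).surjective j
  simp only [Equiv.ofBijective_apply, permHom_apply, F, Equiv.symm_apply_apply]
  rw [MulAction.ofQuotientStabilizer_smul]
  rfl

/-- Transfers determine admissibility: the graph of a homomorphism from `H ≤ G` is studied in `H`,
which is itself a compact Lie group. -/
theorem Operad.admissible_of_transfers {O P : Operad.{u}}
    (hO : ∀ n, (O.space n).IsNonempty) (hP : (P.space 0).IsNonempty)
    (hOP : O.transfers = P.transfers) {G : CompactLieGroup} {n : ℕ}
    {Γ : Subgroup (G × Equiv.Perm (Fin n))} (h : P.Admissible G n Γ) : O.Admissible G n Γ := by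
  obtain ⟨hΓ, hV⟩ := h
  obtain ⟨φ, hφ, h1, h2⟩ := hΓ.exists_hom
  refine ⟨hΓ, (O.toSymmSeq.exists_fixedPoints_nonempty_iff hΓ φ h1 h2).2 ?_⟩
  refine Operad.hasFixedPoint_of_transfers (P := P)
    (H := G.ofClosedSubgroup _ hΓ.isClosed_map_fst) hO hP (fun K => ?_) φ hφ
    ((P.toSymmSeq.exists_fixedPoints_nonempty_iff hΓ φ h1 h2).1 hV)
  rw [hOP]
  exact id

end Transfers

/-! ### Equivalences -/

section Equivalence

/-- The composition of `G`-embeddings. -/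
def OrthRep.Emb.comp {G : CompactLieGroup} {U V W : OrthRep G} (ψ : V.Emb W) (χ : U.Emb V) :
    U.Emb W where
  toIsometry := ψ.toIsometry.comp χ.toIsometry
  equivariance g v := by
    change ψ.toIsometry (χ.toIsometry _) = _
    rw [χ.equivariance, ψ.equivariance]
    rfl

theorem SymmSeq.fixedMap_comp (M : SymmSeq.{u}) {G : CompactLieGroup} {n : ℕ}
    (Γ : Subgroup (G × Equiv.Perm (Fin n))) {U V W : OrthRep G} (ψ : V.Emb W) (χ : U.Emb V) :
    M.fixedMap Γ (ψ.comp χ) = (M.fixedMap Γ ψ).comp (M.fixedMap Γ χ) := by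
  ext x
  exact (M.space n).map_comp _ _ _

theorem SymmSeq.Hom.fixedMap_naturality {M N : SymmSeq.{u}} (f : M.Hom N) {G : CompactLieGroup}
    {n : ℕ} (Γ : Subgroup (G × Equiv.Perm (Fin n))) {V W : OrthRep G} (ψ : V.Emb W) :
    (f.fixedMap Γ W).comp (M.fixedMap Γ ψ) = (N.fixedMap Γ ψ).comp (f.fixedMap Γ V) := by
  ext x
  exact f.naturality _ _

theorem SymmSeq.Hom.admissible {M N : SymmSeq.{u}} (f : M.Hom N) {G : CompactLieGroup} {n : ℕ}
    {Γ : Subgroup (G × Equiv.Perm (Fin n))} (h : M.Admissible G n Γ) : N.Admissible G n Γ :=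
  ⟨h.1, h.2.imp fun V ⟨x, hx⟩ => ⟨_, (f.fixedMap Γ V ⟨x, hx⟩).2⟩⟩

/-- An equivalence reflects admissibility: lift a point, that is, a map from `D⁰`. -/
theorem SymmSeq.Hom.IsEquivalence.admissible {M N : SymmSeq.{u}} {f : M.Hom N}
    (hf : f.IsEquivalence) {G : CompactLieGroup} {n : ℕ}
    {Γ : Subgroup (G × Equiv.Perm (Fin n))} (h : N.Admissible G n Γ) : M.Admissible G n Γ := by
  obtain ⟨hΓ, V, x⟩ := h
  have : IsEmpty (diskBoundary 0) := by
    refine ⟨fun z => ?_⟩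
    have h1 : ‖z.1.1‖ = 1 := z.2
    rw [Subsingleton.elim z.1.1 0, norm_zero] at h1
    exact zero_ne_one h1
  obtain ⟨W, -, lam, -, -⟩ := hf n G Γ hΓ V 0 ⟨fun z => isEmptyElim z, continuous_of_const
    fun z => isEmptyElim z⟩ (ContinuousMap.const _ x.to_subtype.some)
    (by ext z; exact isEmptyElim z)
  exact ⟨hΓ, W, _, (lam ⟨0, by simp⟩).2⟩

/-- A morphism of `N∞`-symmetric sequences which reflects admissibility is an equivalence: fixed
points of admissible graph subgroups have the extension property up to enlarging the
representation, in the source and in the target. -/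
theorem SymmSeq.Hom.isEquivalence_of_admissible {M N : SymmSeq.{u}} (hM : M.IsNInfty)
    (hN : N.IsNInfty) (f : M.Hom N)
    (h : ∀ (G : CompactLieGroup) (n : ℕ) (Γ : Subgroup (G × Equiv.Perm (Fin n))),
      N.Admissible G n Γ → M.Admissible G n Γ) : f.IsEquivalence := by
  intro n G Γ hΓ V l α β hαβ
  have hadm : N.Admissible G n Γ := ⟨hΓ, V, _, (β ⟨0, by simp⟩).2⟩
  obtain ⟨W, ψ, lam, hlam⟩ := (hM n).2 G Γ (h G n Γ hadm) V l α
  have hbd : ∀ z ∈ diskBoundary l,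
      (f.fixedMap Γ W).comp lam z = (N.fixedMap Γ ψ).comp β z := by
    intro z hz
    have h1 := DFunLike.congr_fun hlam ⟨z, hz⟩
    have h2 := DFunLike.congr_fun hαβ ⟨z, hz⟩
    have h3 := DFunLike.congr_fun (f.fixedMap_naturality Γ ψ) (α ⟨z, hz⟩)
    change lam z = M.fixedMap Γ ψ (α ⟨z, hz⟩) at h1
    change f.fixedMap Γ V (α ⟨z, hz⟩) = β z at h2
    change f.fixedMap Γ W (lam z) = N.fixedMap Γ ψ (β z)
    rw [h1, ← h2]
    exact h3
  obtain ⟨W', ψ', F, hF⟩ := (hN n).2 G Γ hadm W (l + 1)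
    (glueHemispheres ((f.fixedMap Γ W).comp lam) ((N.fixedMap Γ ψ).comp β) hbd)
  refine ⟨W', ψ'.comp ψ, (M.fixedMap Γ ψ').comp lam, ?_, ?_⟩
  · rw [M.fixedMap_comp, ContinuousMap.comp_assoc, hlam, ContinuousMap.comp_assoc]
  · rw [N.fixedMap_comp, ← ContinuousMap.comp_assoc, f.fixedMap_naturality,
      ContinuousMap.comp_assoc, ContinuousMap.comp_assoc]
    exact homotopicRel_of_extension _ _ hbd _ F hF

end Equivalence

end

end GlobalOperads

theorem mainTheorem3 (O P : GlobalOperads.Operad.{u}) (hO : O.IsGlobalNInfty)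
    (hP : P.IsGlobalNInfty) (f : O.Hom P) :
    f.IsEquivalence ↔ O.transfers = P.transfers := by
  constructor
  · intro hf
    have h : ∀ G n Γ, O.Admissible G n Γ ↔ P.Admissible G n Γ := fun G n Γ =>
      ⟨f.toHom.admissible, hf.admissible⟩
    funext H K
    simp only [GlobalOperads.Operad.transfers, h]
  · intro h
    exact f.toHom.isEquivalence_of_admissible hO hP fun G n Γ =>
      GlobalOperads.Operad.admissible_of_transfers (fun n => (hO n).1) (hP 0).1 h
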